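/- Lambda-terms are considered up to renaming of bound variables. The De Bruijn index of a bound variable occurrence is the number of abstractions between it and its binding abstraction, the binding abstraction included (so indices start at $1$). The size of a lambda-term is the number of nodes of its lambda-DAG: every variable occurrence (leaf), every application and every abstraction counts $1$. **Theorem.** Let $k\ge 1$ be a fixed integer. For $n\ge 2$ the set of closed lambda-terms of size $n$ in which every De Bruijn index is at most $k$ is finite and non-empty; let $X_n$ be the number of variable occurrences (leaves) of a uniformly random term from this set. Then $X_n$ is asymptotically normally distributed, that is, $$\lim_{n\to\infty}\mathbb{P}\left(\frac{X_n-\mathbb{E}X_n}{\sqrt{\mathbb{V}X_n}}\le x\right)=\frac1{\sqrt{2\pi}}\int_{-\infty}^{x}e^{-t^2/2}\,dt\qquad\text{for all }x\in\mathbb{R},$$ and, as $n\to\infty$, $$\mathbb{E}X_n\sim\frac{k}{\sqrt{k}+2k}\,n,\qquad \mathbb{V}X_n\sim\frac{k^2}{2\sqrt{k}\,(\sqrt{k}+2k)^2}\,n.$$ -/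

import Mathlib

open Filter Topology MeasureTheory ProbabilityTheory Asymptotics

/-- Lambda-terms up to renaming of bound variables, in De Bruijn's representation.  The index of a
variable counts the abstractions between the variable and its binding abstraction, the latter
included; so the smallest index of a bound variable is `1`, and `λx.(λy.xy)` is
`abs (abs (app (var 2) (var 1)))`. -/
inductive LambdaTerm : Type where
  | var : ℕ → LambdaTerm
  | app : LambdaTerm → LambdaTerm → LambdaTerm
  | abs : LambdaTerm → LambdaTerm

namespace LambdaTerm

/-- The number of nodes of the lambda-DAG: one node for each variable occurrence (leaf), for each
application (binary node) and for each abstraction (unary node). -/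
def size : LambdaTerm → ℕ
  | var _ => 1
  | app s t => s.size + t.size + 1
  | abs t => t.size + 1

/-- The number of variables, that is, the number of leaves of the lambda-DAG. -/
def numVars : LambdaTerm → ℕ
  | var _ => 1
  | app s t => s.numVars + t.numVars
  | abs t => t.numVars

/-- `t.ClosedUnder m`: every variable of `t` is bound once `t` is placed below `m` abstractions. -/
def ClosedUnder : LambdaTerm → ℕ → Prop
  | var i, m => 1 ≤ i ∧ i ≤ m
  | app s t, m => s.ClosedUnder m ∧ t.ClosedUnder m
  | abs t, m => t.ClosedUnder (m + 1)

/-- A term is closed if each of its variables is bound by an abstraction of the term. -/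
def Closed (t : LambdaTerm) : Prop := t.ClosedUnder 0

/-- Every De Bruijn index occurring in the term is at most `k`. -/
def IndicesLE (k : ℕ) : LambdaTerm → Prop
  | var i => i ≤ k
  | app s t => s.IndicesLE k ∧ t.IndicesLE k
  | abs t => t.IndicesLE k

/-- The closed lambda-terms of size `n` all of whose De Bruijn indices are at most `k`. -/
def closedTerms (k n : ℕ) : Set LambdaTerm :=
  {t | t.Closed ∧ t.IndicesLE k ∧ t.size = n}

instance : MeasurableSpace LambdaTerm := ⊤

/-- The law of a uniformly random closed lambda-term of size `n` with De Bruijn indices at most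
`k`: the uniform probability measure on the finite set `closedTerms k n`.  (It is the zero measure
if there is no such term.) -/
noncomputable def uniformLaw (k n : ℕ) : Measure LambdaTerm :=
  uniformOn (closedTerms k n)

/-- The number of variables `X_n`, as a real-valued random variable on lambda-terms. -/
def X (t : LambdaTerm) : ℝ := (t.numVars : ℝ)

theorem finite_indicesLE_size (k n : ℕ) :
    {t : LambdaTerm | t.IndicesLE k ∧ t.size ≤ n}.Finite := by
  induction n with
  | zero =>
    convert Set.finite_empty
    ext t
    cases t <;> simp [size]
  | succ n ih =>
    refine (((Set.finite_Iic k).image var).union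
      ((ih.image2 app ih).union (ih.image abs))).subset ?_
    rintro (i | ⟨s, t⟩ | t) ⟨h1, h2⟩
    · exact Or.inl ⟨i, h1, rfl⟩
    · simp only [size] at h2
      exact Or.inr (Or.inl ⟨s, ⟨h1.1, by omega⟩, t, ⟨h1.2, by omega⟩, rfl⟩)
    · simp only [size] at h2
      exact Or.inr (Or.inr ⟨t, ⟨h1, by omega⟩, rfl⟩)

theorem finite_closedTerms (k n : ℕ) : (closedTerms k n).Finite :=
  (finite_indicesLE_size k n).subset fun _ h => ⟨h.2.1, h.2.2.le⟩

theorem nonempty_closedTerms {k n : ℕ} (hk : 1 ≤ k) (hn : 2 ≤ n) :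
    (closedTerms k n).Nonempty := by
  have key : ∀ j m, ∃ t : LambdaTerm,
      t.ClosedUnder (m + 1) ∧ t.IndicesLE k ∧ t.size = j + 1 := by
    intro j
    induction j with
    | zero => exact fun m => ⟨var 1, ⟨le_rfl, by omega⟩, hk, rfl⟩
    | succ j ih =>
      intro m
      obtain ⟨t, h1, h2, h3⟩ := ih (m + 1)
      exact ⟨abs t, h1, h2, by simp [size, h3]⟩
  obtain ⟨t, h1, h2, h3⟩ := key (n - 2) 0
  exact ⟨abs t, h1, h2, by simp only [size, h3]; omega⟩

instance : MeasurableSingletonClass LambdaTerm := ⟨fun _ => trivial⟩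

theorem isProbabilityMeasure_uniformLaw {k n : ℕ} (hk : 1 ≤ k) (hn : 2 ≤ n) :
    IsProbabilityMeasure (uniformLaw k n) :=
  isProbabilityMeasure_uniformOn (finite_closedTerms k n) (nonempty_closedTerms hk hn)

end LambdaTerm

/-! The number of variables behaves like half of a binomial variable with parameters `n` and `α =
leafRate k`. Let `F_m(z, u)` count the terms closed under `m` abstractions, with `z` for size and
`u` for leaves. Splitting at the root gives `F_m = min(m, k) u z + z F_m² + z F_{m+1}`, and the
index bound gives `F_{k+1} = F_k`, so the system is a chain of `k + 1` quadratic equations. Put `u =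
v²`. At level `k` the dominant singularity is a square root at `ρ(v) = 1 / (1 + 2 √k v)`. At each
lower level the equation is subcritical, so `F_0` inherits the same singularity with a nonzero
constant.

The transfer from singularity to coefficients works on coefficient sequences. `UniformTail` says
that the rescaled coefficients, times `(n + 1)^(3/2)`, tend to a constant as `n → ∞` and `v → 1`
jointly. The property passes through products (`UniformTail.mul`) and subcritical composition
(`UniformTail.subst`). It holds at level `k` by `exists_uniformTail_of_quadratic` and descends by
`exists_uniformTail_scaledGF_of_succ`.

Consequently `[zⁿ] F_0(z, v²) / [zⁿ] F_0(z, 1)` is asymptotic to `(ρ(1) / ρ(v))^(n+1) = (1 - α + α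
v)^(n+1)`. With `v = exp(s / (2√n))` this gives convergence of the moment generating functions for
complex `s`, locally uniformly (`tendsto_deviationMGF`). Differentiating twice at `0` yields mean
and variance; imaginary `s` and Lévy's continuity theorem yield the normal limit. -/

/-! ### The weight `(n + 1) ^ (3 / 2)` -/

/-- The weight `(n + 1) ^ (3 / 2)`. -/
noncomputable def weight (n : ℕ) : ℝ := ((n : ℝ) + 1) ^ (3 / 2 : ℝ)

theorem weight_pos (n : ℕ) : 0 < weight n := by unfold weight; positivity

theorem weight_le {c : ℝ} (hc : 0 ≤ c) {m n : ℕ} (h : (n : ℝ) + 1 ≤ c * (m + 1)) :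
    weight n ≤ c ^ (3 / 2 : ℝ) * weight m := by
  unfold weight
  rw [← Real.mul_rpow hc (by positivity)]
  exact Real.rpow_le_rpow (by positivity) h (by norm_num)

theorem summable_inv_weight : Summable fun n => (weight n)⁻¹ := by
  have h := (Real.summable_one_div_nat_add_rpow 1 (3 / 2)).2 (by norm_num)
  refine h.congr fun n => ?_
  rw [abs_of_pos (by positivity), weight, one_div]

theorem tendsto_weight_div_weight_sub (i : ℕ) :
    Tendsto (fun n => weight n / weight (n - i)) atTop (𝓝 1) := by
  have h1 : Tendsto (fun n : ℕ => ((n : ℝ) + 1 + i) / (n + 1)) atTop (𝓝 1) := by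
    have h2 : Tendsto (fun n : ℕ => 1 + (i : ℝ) * (1 / ((n : ℝ) + 1))) atTop (𝓝 (1 + i * 0)) :=
      (tendsto_one_div_add_atTop_nhds_zero_nat.const_mul _).const_add _
    rw [mul_zero, add_zero] at h2
    refine h2.congr fun n => ?_
    field_simp
  have h3 : Tendsto (fun n : ℕ => (((n : ℝ) + 1 + i) / (n + 1)) ^ (3 / 2 : ℝ)) atTop (𝓝 1) := by
    simpa using h1.rpow_const (p := 3 / 2) (Or.inl one_ne_zero)
  rw [← tendsto_add_atTop_iff_nat i]
  refine h3.congr fun n => ?_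
  simp only [Nat.add_sub_cancel, weight]
  rw [Real.div_rpow (by positivity) (by positivity)]
  push_cast
  ring_nf

theorem tendsto_weight_mul_pow {b : ℝ} (hb0 : 0 ≤ b) (hb : b < 1) :
    Tendsto (fun n => weight n * b ^ n) atTop (𝓝 0) := by
  have h0 : Tendsto (fun n : ℕ => (n : ℝ) ^ 2 * b ^ n) atTop (𝓝 0) :=
    tendsto_pow_const_mul_const_pow_of_abs_lt_one 2 (by rwa [abs_of_nonneg hb0])
  refine squeeze_zero' (g := fun n : ℕ => 4 * ((n : ℝ) ^ 2 * b ^ n))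
    (.of_forall fun n => mul_nonneg (weight_pos n).le (by positivity)) ?_ (by simpa using h0.const_mul 4)
  filter_upwards [eventually_ge_atTop 1] with n hn
  have hn' : (1 : ℝ) ≤ n := by exact_mod_cast hn
  have h1 : weight n ≤ ((n : ℝ) + 1) ^ (2 : ℝ) :=
    Real.rpow_le_rpow_of_exponent_le (by linarith) (by norm_num)
  rw [Real.rpow_two] at h1
  rw [← mul_assoc]
  gcongr
  nlinarith

/-! ### Power series with uniform tails -/

section UniformTail

open PowerSeries

variable {α : Type*} {l : Filter α}

/-- The coefficients of the power series `f v` converge along `l` to those of `f₀`, and, jointly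
in `v` and `n`, the `n`-th coefficient of `f v` is asymptotic to `L / (n + 1) ^ (3 / 2)`. -/
structure UniformTail (l : Filter α) (f : α → ℂ⟦X⟧) (f₀ : ℂ⟦X⟧) (L : ℂ) : Prop where
  tendsto_coeff : ∀ n, Tendsto (fun v => coeff n (f v)) l (𝓝 (coeff n f₀))
  tendsto_tail : Tendsto (fun p : α × ℕ => (weight p.2 : ℂ) * coeff p.2 (f p.1)) (l ×ˢ atTop) (𝓝 L)

/-- The value at `1` of a power series, as the sum of its coefficients. -/
noncomputable def evalOne (f : ℂ⟦X⟧) : ℂ := ∑' n, coeff n f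

/-- The coefficients are absolutely summable. -/
def AbsSummable (f : ℂ⟦X⟧) : Prop := Summable fun n => ‖coeff n f‖

theorem AbsSummable.mul {f g : ℂ⟦X⟧} (hf : AbsSummable f) (hg : AbsSummable g) :
    AbsSummable (f * g) := by
  have hf' : Summable fun n => ‖coeff n f‖ := hf
  have hg' : Summable fun n => ‖coeff n g‖ := hg
  exact (summable_norm_sum_mul_antidiagonal_of_summable_norm hf' hg').congr fun n => by
    rw [coeff_mul]

theorem evalOne_mul {f g : ℂ⟦X⟧} (hf : AbsSummable f) (hg : AbsSummable g) :
    evalOne (f * g) = evalOne f * evalOne g := by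
  have hf' : Summable fun n => ‖coeff n f‖ := hf
  have hg' : Summable fun n => ‖coeff n g‖ := hg
  unfold evalOne
  rw [tsum_mul_tsum_eq_tsum_sum_antidiagonal_of_summable_norm hf' hg']
  exact tsum_congr fun n => coeff_mul n f g

theorem evalOne_add {f g : ℂ⟦X⟧} (hf : AbsSummable f) (hg : AbsSummable g) :
    evalOne (f + g) = evalOne f + evalOne g := by
  unfold evalOne
  simp only [map_add]
  exact hf.of_norm.tsum_add hg.of_norm

theorem tsum_norm_mul_le {f g : ℂ⟦X⟧} (hf : AbsSummable f) (hg : AbsSummable g) :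
    ∑' n, ‖coeff n (f * g)‖ ≤ (∑' n, ‖coeff n f‖) * ∑' n, ‖coeff n g‖ := by
  have hf' : Summable fun n => ‖‖coeff n f‖‖ := by simpa [AbsSummable] using hf
  have hg' : Summable fun n => ‖‖coeff n g‖‖ := by simpa [AbsSummable] using hg
  rw [tsum_mul_tsum_eq_tsum_sum_antidiagonal_of_summable_norm hf' hg']
  refine (hf.mul hg).tsum_le_tsum (fun n => ?_)
    (summable_norm_sum_mul_antidiagonal_of_summable_norm hf' hg').of_norm
  rw [coeff_mul]
  exact (norm_sum_le _ _).trans_eq (by simp)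

theorem evalOne_C (c : ℂ) : evalOne (C c) = c := by
  unfold evalOne
  rw [tsum_eq_single 0 fun n hn => by simp [coeff_C, hn]]
  simp

theorem evalOne_X : evalOne (X : ℂ⟦X⟧) = 1 := by
  unfold evalOne
  rw [tsum_eq_single 1 fun n hn => by simp [coeff_X, hn]]
  simp

/-- The `n`-th coefficient of a power of a power series `f` with coefficients `O(n ^ (-3/2))`
and absolute sum at most `r`. -/
theorem norm_coeff_pow_le {f : ℂ⟦X⟧} {c r : ℝ} (hr : 0 ≤ r)
    (hb : ∀ n, ‖coeff n f‖ ≤ c / weight n) (hs : AbsSummable f) (hfr : ∑' n, ‖coeff n f‖ ≤ r)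
    (j : ℕ) :
    (AbsSummable (f ^ (j + 1)) ∧ ∑' n, ‖coeff n (f ^ (j + 1))‖ ≤ r ^ (j + 1)) ∧
    ∀ n, ‖coeff n (f ^ (j + 1))‖ ≤
      c * (j + 1) * ((j : ℝ) + 1) ^ (3 / 2 : ℝ) * r ^ j / weight n := by
  have hc : 0 ≤ c := by
    have := (norm_nonneg _).trans (hb 0)
    simpa [weight] using this
  induction j with
  | zero => exact ⟨by simpa using ⟨hs, hfr⟩, by simpa using hb⟩
  | succ j ih =>
    obtain ⟨⟨ih1, ih2⟩, ih3⟩ := ih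
    refine ⟨⟨?_, ?_⟩, fun n => ?_⟩
    · rw [pow_succ]; exact ih1.mul hs
    · rw [pow_succ, pow_succ r]
      exact (tsum_norm_mul_le ih1 hs).trans
        (mul_le_mul ih2 hfr (tsum_nonneg fun _ => norm_nonneg _) (by positivity))
    · set J : ℝ := (j : ℝ) + 1 with hJ
      have hJ0 : 0 < J := by positivity
      set K : ℝ := (J + 1) ^ (3 / 2 : ℝ) with hK
      have hK0 : 0 ≤ K := by positivity
      have hw := weight_pos n
      have key : ∀ p ∈ Finset.HasAntidiagonal.antidiagonal n,
          ‖coeff p.1 (f ^ (j + 1)) * coeff p.2 f‖ ≤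
            c * K / weight n * ‖coeff p.1 (f ^ (j + 1))‖ +
            c * J * K * r ^ j / weight n * ‖coeff p.2 f‖ := by
        rintro ⟨a, b⟩ hab
        rw [Finset.HasAntidiagonal.mem_antidiagonal] at hab
        have hab' : (a : ℝ) + b = n := by exact_mod_cast hab
        rw [norm_mul]
        -- Either `b` has at least its share `1 / (J + 1)` of `n + 1`, or `a` has at least `J / (J +
        -- 1)`. This uneven cut keeps the constant polynomial in `j`; cutting in the middle would
        -- cost a factor `2^(3/2)` for each multiplication.
        by_cases h : (n : ℝ) + 1 ≤ (J + 1) * (b + 1)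
        · have h1 : ‖coeff b f‖ ≤ c * K / weight n := by
            refine (hb b).trans ?_
            rw [div_le_div_iff₀ (weight_pos b) hw, mul_assoc]
            exact mul_le_mul_of_nonneg_left (weight_le (by positivity) h) hc
          have h2 : 0 ≤ c * J * K * r ^ j / weight n * ‖coeff b f‖ := by positivity
          have h3 := mul_le_mul_of_nonneg_left h1 (norm_nonneg (coeff a (f ^ (j + 1))))
          simp only
          linarith
        · have h' : (n : ℝ) + 1 ≤ (J + 1) / J * (a + 1) := by
            rw [div_mul_eq_mul_div, le_div_iff₀ hJ0]
            push Not at h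
            nlinarith
          have h1 : ‖coeff a (f ^ (j + 1))‖ ≤ c * J * K * r ^ j / weight n := by
            refine (ih3 a).trans ?_
            rw [div_le_div_iff₀ (weight_pos a) hw]
            have h4 := weight_le (by positivity) h'
            rw [Real.div_rpow (by positivity) (by positivity), div_mul_eq_mul_div,
              le_div_iff₀ (by positivity)] at h4
            calc c * J * J ^ (3 / 2 : ℝ) * r ^ j * weight n
                = (c * J * r ^ j) * (weight n * J ^ (3 / 2 : ℝ)) := by ring
              _ ≤ (c * J * r ^ j) * (K * weight a) := by gcongr
              _ = _ := by ring
          have h2 : 0 ≤ c * K / weight n * ‖coeff a (f ^ (j + 1))‖ := by positivity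
          have h3 := mul_le_mul_of_nonneg_right h1 (norm_nonneg (coeff b f))
          simp only
          linarith
      have s1 : ∑ p ∈ Finset.HasAntidiagonal.antidiagonal n, ‖coeff p.1 (f ^ (j + 1))‖ ≤ r ^ (j + 1) := by
        rw [Finset.Nat.sum_antidiagonal_eq_sum_range_succ_mk]
        exact (ih1.sum_le_tsum _ fun _ _ => norm_nonneg _).trans ih2
      have s2 : ∑ p ∈ Finset.HasAntidiagonal.antidiagonal n, ‖coeff p.2 f‖ ≤ r := by
        rw [← Finset.Nat.sum_antidiagonal_swap]
        simp only [Prod.snd_swap]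
        rw [Finset.Nat.sum_antidiagonal_eq_sum_range_succ_mk]
        exact (hs.sum_le_tsum _ fun _ _ => norm_nonneg _).trans hfr
      rw [pow_succ f, coeff_mul]
      refine (norm_sum_le _ _).trans ((Finset.sum_le_sum key).trans ?_)
      rw [Finset.sum_add_distrib, ← Finset.mul_sum, ← Finset.mul_sum]
      calc _ ≤ c * K / weight n * r ^ (j + 1) + c * J * K * r ^ j / weight n * r := by gcongr
        _ = _ := by push_cast; rw [← hJ, ← hK]; ring

namespace UniformTail

variable {f g : α → ℂ⟦X⟧} {f₀ g₀ : ℂ⟦X⟧} {L M : ℂ}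

/-- The joint limit controls all `n ≥ N` at once; coefficientwise convergence controls the finitely
many `n < N`. -/
theorem bound (hf : UniformTail l f f₀ L) :
    ∃ c : ℝ, 0 ≤ c ∧ ∀ᶠ v in l, ∀ n, ‖coeff n (f v)‖ ≤ c / weight n := by
  have h1 : ∀ᶠ p in l ×ˢ atTop, ‖(weight p.2 : ℂ) * coeff p.2 (f p.1)‖ < ‖L‖ + 1 :=
    hf.tendsto_tail.norm.eventually_lt_const (lt_add_one _)
  obtain ⟨pa, hpa, pb, hpb, hab⟩ := eventually_prod_iff.1 h1
  obtain ⟨N, hN⟩ := eventually_atTop.1 hpb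
  have h2 : ∀ᶠ v in l, ∀ n ∈ Finset.range N,
      weight n * ‖coeff n (f v)‖ < weight n * ‖coeff n f₀‖ + 1 := by
    rw [Filter.eventually_all_finset]
    exact fun n _ => ((hf.tendsto_coeff n).norm.const_mul _).eventually_lt_const (lt_add_one _)
  refine ⟨‖L‖ + 1 + ∑ n ∈ Finset.range N, (weight n * ‖coeff n f₀‖ + 1), ?_, ?_⟩
  · have : ∀ n ∈ Finset.range N, 0 ≤ weight n * ‖coeff n f₀‖ + 1 := fun n _ => by
      have := weight_pos n
      positivity
    have := Finset.sum_nonneg this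
    positivity
  · filter_upwards [hpa, h2] with v hv1 hv2 n
    have hn : ∀ n, 0 ≤ weight n * ‖coeff n f₀‖ + 1 := fun n => by
      have := weight_pos n
      positivity
    rw [le_div_iff₀ (weight_pos n), mul_comm]
    by_cases h : n < N
    · have := Finset.single_le_sum (fun n _ => hn n) (Finset.mem_range.2 h)
      have := hv2 n (Finset.mem_range.2 h)
      have := norm_nonneg L
      linarith
    · have := hab hv1 (hN n (not_lt.1 h))
      rw [norm_mul, Complex.norm_real, Real.norm_of_nonneg (weight_pos n).le] at this
      have := Finset.sum_nonneg (s := Finset.range N) (fun n _ => hn n)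
      linarith

theorem bound_limit [l.NeBot] (hf : UniformTail l f f₀ L) {c : ℝ}
    (h : ∀ᶠ v in l, ∀ n, ‖coeff n (f v)‖ ≤ c / weight n) (n : ℕ) :
    ‖coeff n f₀‖ ≤ c / weight n :=
  le_of_tendsto (hf.tendsto_coeff n).norm (h.mono fun _ hv => hv n)

theorem _root_.AbsSummable.of_le_weight {f : ℂ⟦X⟧} {c : ℝ}
    (h : ∀ n, ‖coeff n f‖ ≤ c / weight n) : AbsSummable f := by
  refine Summable.of_nonneg_of_le (fun _ => norm_nonneg _) h ?_
  simpa only [div_eq_mul_inv] using summable_inv_weight.mul_left c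

theorem absSummable [l.NeBot] (hf : UniformTail l f f₀ L) : AbsSummable f₀ := by
  obtain ⟨c, -, h⟩ := hf.bound
  exact .of_le_weight (hf.bound_limit h)

theorem congr' (hf : UniformTail l f f₀ L) (h : ∀ᶠ v in l, f v = g v) :
    UniformTail l g f₀ L where
  tendsto_coeff n := (hf.tendsto_coeff n).congr' (h.mono fun v hv => by rw [hv])
  tendsto_tail := hf.tendsto_tail.congr' ((h.prod_inl atTop).mono fun p hp => by rw [hp])

theorem add (hf : UniformTail l f f₀ L) (hg : UniformTail l g g₀ M) :
    UniformTail l (fun v => f v + g v) (f₀ + g₀) (L + M) where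
  tendsto_coeff n := by simpa using (hf.tendsto_coeff n).add (hg.tendsto_coeff n)
  tendsto_tail := by simpa [mul_add] using hf.tendsto_tail.add hg.tendsto_tail

theorem of_eventually_zero {N : ℕ} (hf : ∀ n, Tendsto (fun v => coeff n (f v)) l (𝓝 (coeff n f₀)))
    (h : ∀ v, ∀ n, N ≤ n → coeff n (f v) = 0) : UniformTail l f f₀ 0 where
  tendsto_coeff := hf
  tendsto_tail := by
    refine tendsto_const_nhds.congr' ?_
    filter_upwards [(eventually_ge_atTop N).prod_inr l] with p hp
    rw [h _ _ hp, mul_zero]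

theorem C {c : α → ℂ} {c₀ : ℂ} (hc : Tendsto c l (𝓝 c₀)) :
    UniformTail l (fun v => PowerSeries.C (c v)) (PowerSeries.C c₀) 0 := by
  refine of_eventually_zero (N := 1) (fun n => ?_) fun v n hn => by
    rw [coeff_C, if_neg (by omega)]
  by_cases hn : n = 0
  · simpa [coeff_C, hn] using hc
  · simpa [coeff_C, hn] using tendsto_const_nhds

theorem X : UniformTail l (fun _ => (PowerSeries.X : ℂ⟦X⟧)) PowerSeries.X 0 :=
  of_eventually_zero (N := 2) (fun _ => tendsto_const_nhds) fun v n hn => by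
    rw [coeff_X, if_neg (by omega)]

/-- One half of the Cauchy product: the pairs in which the first index is the smaller one. -/
theorem tendsto_half_mul [l.NeBot] (hf : UniformTail l f f₀ L) (hg : UniformTail l g g₀ M)
    (c : ℕ → ℕ → Prop) [∀ n i, Decidable (c n i)] (hc : ∀ n i, c n i → 2 * i ≤ n)
    (hc' : ∀ i, ∀ᶠ n in atTop, c n i) :
    Tendsto (fun p : α × ℕ => ∑' i, if c p.2 i then
      coeff i (f p.1) * ((weight p.2 : ℂ) * coeff (p.2 - i) (g p.1)) else 0)
      (l ×ˢ atTop) (𝓝 (evalOne f₀ * M)) := by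
  obtain ⟨a, ha, hfa⟩ := hf.bound
  obtain ⟨b, hb, hgb⟩ := hg.bound
  have e : evalOne f₀ * M = ∑' i, coeff i f₀ * M := by rw [evalOne, tsum_mul_right]
  rw [e]
  refine tendsto_tsum_of_dominated_convergence
    (bound := fun i => a / weight i * (2 ^ (3 / 2 : ℝ) * b)) ?_ (fun i => ?_) ?_
  · simp only [div_eq_mul_inv]
    exact (summable_inv_weight.mul_left a).mul_right _
  · have h1 : Tendsto (fun p : α × ℕ => coeff i (f p.1)) (l ×ˢ atTop) (𝓝 (coeff i f₀)) :=
      (hf.tendsto_coeff i).comp tendsto_fst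
    have h2 : Tendsto (fun p : α × ℕ => ((weight p.2 / weight (p.2 - i) : ℝ) : ℂ))
        (l ×ˢ atTop) (𝓝 ((1 : ℝ) : ℂ)) :=
      (Complex.continuous_ofReal.tendsto 1).comp
        ((tendsto_weight_div_weight_sub i).comp tendsto_snd)
    have h3 : Tendsto (fun p : α × ℕ => (weight (p.2 - i) : ℂ) * coeff (p.2 - i) (g p.1))
        (l ×ˢ atTop) (𝓝 M) := by
      have h : Tendsto (fun p : α × ℕ => (p.1, p.2 - i)) (l ×ˢ atTop) (l ×ˢ atTop) :=
        tendsto_fst.prodMk ((tendsto_sub_atTop_nat i).comp tendsto_snd)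
      exact (Tendsto.comp hg.tendsto_tail h).congr fun _ => by simp only [Function.comp_apply]
    have h4 := h1.mul (h2.mul h3)
    rw [Complex.ofReal_one, one_mul] at h4
    refine h4.congr' ?_
    filter_upwards [(hc' i).prod_inr l] with p hp
    have : (weight (p.2 - i) : ℂ) ≠ 0 := by exact_mod_cast (weight_pos _).ne'
    rw [if_pos hp]
    push_cast
    field_simp
  · filter_upwards [(hfa.and hgb).prod_inl atTop] with p hp i
    have hwi := weight_pos i
    by_cases h : c p.2 i
    · rw [if_pos h, norm_mul, norm_mul, Complex.norm_real, Real.norm_of_nonneg (weight_pos _).le]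
      refine mul_le_mul (hp.1 i) ?_ (mul_nonneg (weight_pos _).le (norm_nonneg _)) (by positivity)
      -- Since `2 i ≤ n`, the complementary index is at least `n / 2`, which gives a dominating term
      -- independent of `n`.
      have h1 : weight p.2 ≤ 2 ^ (3 / 2 : ℝ) * weight (p.2 - i) := by
        refine weight_le zero_le_two ?_
        have h2 := hc _ _ h
        rw [Nat.cast_sub (by omega)]
        have h3 : (2 : ℝ) * i ≤ p.2 := by exact_mod_cast h2
        linarith
      have hw := weight_pos (p.2 - i)
      calc _ ≤ weight p.2 * (b / weight (p.2 - i)) :=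
            mul_le_mul_of_nonneg_left (hp.2 _) (weight_pos _).le
        _ ≤ 2 ^ (3 / 2 : ℝ) * weight (p.2 - i) * (b / weight (p.2 - i)) := by gcongr
        _ = _ := by field_simp
    · rw [if_neg h, norm_zero]
      positivity

/-- A coefficient of order `n^(-3/2)` in a product arises when one index is bounded and the other is
close to `n`. The two halves use `≤` and `<`, so that the middle pair is counted once. -/
theorem mul [l.NeBot] (hf : UniformTail l f f₀ L) (hg : UniformTail l g g₀ M) :
    UniformTail l (fun v => f v * g v) (f₀ * g₀) (evalOne f₀ * M + evalOne g₀ * L) where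
  tendsto_coeff n := by
    simp only [coeff_mul]
    exact tendsto_finsetSum _ fun p _ => (hf.tendsto_coeff _).mul (hg.tendsto_coeff _)
  tendsto_tail := by
    have h1 := hf.tendsto_half_mul hg (fun n i => 2 * i ≤ n) (fun _ _ h => h)
      fun i => eventually_ge_atTop (2 * i)
    have h2 := hg.tendsto_half_mul hf (fun n i => 2 * i < n) (fun _ _ h => h.le)
      fun i => eventually_gt_atTop (2 * i)
    refine (h1.add h2).congr fun p => ?_
    have e1 : ∀ n : ℕ, ∑' i, (if 2 * i ≤ n then
        coeff i (f p.1) * ((weight n : ℂ) * coeff (n - i) (g p.1)) else 0) =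
        ∑ q ∈ Finset.HasAntidiagonal.antidiagonal n, if 2 * q.1 ≤ n then
          coeff q.1 (f p.1) * ((weight n : ℂ) * coeff q.2 (g p.1)) else 0 := fun n => by
      rw [Finset.Nat.sum_antidiagonal_eq_sum_range_succ_mk]
      exact tsum_eq_sum fun i hi => if_neg (by simp at hi; omega)
    have e2 : ∀ n : ℕ, ∑' i, (if 2 * i < n then
        coeff i (g p.1) * ((weight n : ℂ) * coeff (n - i) (f p.1)) else 0) =
        ∑ q ∈ Finset.HasAntidiagonal.antidiagonal n, if 2 * q.2 < n then
          coeff q.2 (g p.1) * ((weight n : ℂ) * coeff q.1 (f p.1)) else 0 := fun n => by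
      rw [← Finset.Nat.sum_antidiagonal_swap]
      simp only [Prod.snd_swap, Prod.fst_swap]
      rw [Finset.Nat.sum_antidiagonal_eq_sum_range_succ_mk]
      exact tsum_eq_sum fun i hi => if_neg (by simp at hi; omega)
    rw [e1, e2, ← Finset.sum_add_distrib, coeff_mul, Finset.mul_sum]
    refine Finset.sum_congr rfl fun q hq => ?_
    rw [Finset.HasAntidiagonal.mem_antidiagonal] at hq
    by_cases h : 2 * q.1 ≤ p.2
    · rw [if_pos h, if_neg (by omega)]; ring
    · rw [if_neg h, if_pos (by omega)]; ring

theorem pow_succ [l.NeBot] (hf : UniformTail l f f₀ L) (j : ℕ) :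
    ∃ M, UniformTail l (fun v => f v ^ (j + 1)) (f₀ ^ (j + 1)) M := by
  induction j with
  | zero => exact ⟨L, by simpa using hf⟩
  | succ j ih =>
    obtain ⟨M, hM⟩ := ih
    exact ⟨_, by simpa only [_root_.pow_succ _ (j + 1)] using hM.mul hf⟩

theorem tail_unique [l.NeBot] (hf : UniformTail l f f₀ L) (hf' : UniformTail l f f₀ M) : L = M :=
  tendsto_nhds_unique hf.tendsto_tail hf'.tendsto_tail

end UniformTail

end UniformTail

/-! ### Subcritical composition of power series -/

section Subst

open PowerSeries

variable {α : Type*} {l : Filter α}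

theorem PowerSeries.coeff_pow_eq_zero {R : Type*} [CommRing R] {f : R⟦X⟧}
    (hf : constantCoeff f = 0) {n j : ℕ} (h : n < j) : coeff n (f ^ j) = 0 :=
  X_pow_dvd_iff.1 (pow_dvd_pow_of_dvd (X_dvd_iff.2 hf) j) n h

theorem PowerSeries.coeff_subst_eq_sum {R : Type*} [CommRing R] {f : R⟦X⟧}
    (hf : constantCoeff f = 0) (a : R⟦X⟧) (n : ℕ) :
    coeff n (a.subst f) = ∑ j ∈ Finset.range (n + 1), coeff j a * coeff n (f ^ j) := by
  rw [coeff_subst' (HasSubst.of_constantCoeff_zero' hf)]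
  simp only [smul_eq_mul]
  refine finsum_eq_sum_of_support_subset _ fun j hj => ?_
  by_contra h
  refine hj ?_
  simp only [Finset.coe_range, Set.mem_Iio, not_lt] at h
  simp only [coeff_pow_eq_zero hf (show n < j by omega), mul_zero]

namespace UniformTail

variable {f : α → ℂ⟦X⟧} {f₀ : ℂ⟦X⟧} {L : ℂ}

/-- By dominated convergence the absolute sum converges along `l`, so a strict bound on the limit
persists. -/
theorem exists_norm_bound [l.NeBot] (hf : UniformTail l f f₀ L) {s : ℝ}
    (hs : ∑' n, ‖coeff n f₀‖ < s) :
    ∃ c : ℝ, 0 ≤ c ∧ ∀ᶠ v in l, (∀ n, ‖coeff n (f v)‖ ≤ c / weight n) ∧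
      AbsSummable (f v) ∧ ∑' n, ‖coeff n (f v)‖ ≤ s := by
  obtain ⟨c, hc0, hc⟩ := hf.bound
  have h : Tendsto (fun v => ∑' n, ‖coeff n (f v)‖) l (𝓝 (∑' n, ‖coeff n f₀‖)) := by
    refine tendsto_tsum_of_dominated_convergence (bound := fun n => c / weight n) ?_
      (fun n => (hf.tendsto_coeff n).norm) ?_
    · simpa only [div_eq_mul_inv] using summable_inv_weight.mul_left c
    · simpa using hc
  refine ⟨c, hc0, ?_⟩
  filter_upwards [hc, h.eventually_lt_const hs] with v h1 h2
  exact ⟨h1, .of_le_weight h1, h2.le⟩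

/-- Each power of `f` has a uniform tail by `mul`. An absolute sum below `1` makes the bounds of
`norm_coeff_pow_le` summable over the exponent, so the tails can be added termwise. -/
theorem subst [l.NeBot] (hf : UniformTail l f f₀ L) (h0 : ∀ v, constantCoeff (f v) = 0)
    (hf1 : ∑' n, ‖coeff n f₀‖ < 1) {a : ℂ⟦X⟧} (ha : ∀ n, ‖coeff n a‖ ≤ 1) :
    ∃ M, UniformTail l (fun v => a.subst (f v)) (a.subst f₀) M := by
  have h00 : constantCoeff f₀ = 0 := by
    have h := hf.tendsto_coeff 0
    simp only [coeff_zero_eq_constantCoeff, h0] at h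
    exact tendsto_nhds_unique h tendsto_const_nhds
  obtain ⟨s, hs1, hs2⟩ := exists_between hf1
  have hs0 : 0 ≤ s := (tsum_nonneg fun _ => norm_nonneg _).trans hs1.le
  obtain ⟨c, hc0, hc⟩ := hf.exists_norm_bound hs1
  choose M hM using hf.pow_succ
  refine ⟨∑' j, coeff (j + 1) a * M j, fun n => ?_, ?_⟩
  · simp only [coeff_subst_eq_sum (h0 _), coeff_subst_eq_sum h00]
    refine tendsto_finsetSum _ fun j _ => Tendsto.const_mul _ ?_
    cases j with
    | zero => simp
    | succ j => exact (hM j).tendsto_coeff n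
  · have h : Tendsto (fun p : α × ℕ => ∑' j, coeff (j + 1) a *
        ((weight p.2 : ℂ) * coeff p.2 (f p.1 ^ (j + 1)))) (l ×ˢ atTop)
        (𝓝 (∑' j, coeff (j + 1) a * M j)) := by
      refine tendsto_tsum_of_dominated_convergence
        -- The growth `(j + 1)^(5/2)` is rounded up to a cube, so that summability reduces to
        -- polynomial times geometric terms; the factor `8` is slack.
        (bound := fun j : ℕ => c * ((8 * (j + 1) ^ 3) * s ^ j)) ?_
        (fun j => (hM j).tendsto_tail.const_mul _) ?_
      · refine Summable.mul_left _ ?_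
        have hs' : ‖s‖ < 1 := by rwa [Real.norm_of_nonneg hs0]
        have := ((summable_pow_mul_geometric_of_norm_lt_one 3 hs').add
          (((summable_pow_mul_geometric_of_norm_lt_one 2 hs').mul_left 3).add
          (((summable_pow_mul_geometric_of_norm_lt_one 1 hs').mul_left 3).add
          (summable_pow_mul_geometric_of_norm_lt_one 0 hs')))).mul_left 8
        refine this.congr fun j => ?_
        ring
      · filter_upwards [hc.prod_inl atTop] with p hp j
        obtain ⟨h1, h2, h3⟩ := hp
        have hw := weight_pos p.2
        have h4 := (norm_coeff_pow_le hs0 h1 h2 h3 j).2 p.2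
        rw [le_div_iff₀ hw] at h4
        have h5 : ((j : ℝ) + 1) ^ (3 / 2 : ℝ) ≤ (j + 1) ^ 2 := by
          rw [← Real.rpow_two]
          exact Real.rpow_le_rpow_of_exponent_le (by linarith [(Nat.cast_nonneg j : (0:ℝ) ≤ j)])
            (by norm_num)
        rw [norm_mul, norm_mul, Complex.norm_real, Real.norm_of_nonneg hw.le]
        calc _ ≤ 1 * (weight p.2 * ‖coeff p.2 (f p.1 ^ (j + 1))‖) := by
              gcongr
              exact ha _
          _ ≤ c * (j + 1) * ((j : ℝ) + 1) ^ (3 / 2 : ℝ) * s ^ j := by linarith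
          _ ≤ c * (j + 1) * (j + 1) ^ 2 * s ^ j := by gcongr
          _ = c * ((1 * (j + 1) ^ 3) * s ^ j) := by ring
          _ ≤ _ := by gcongr; norm_num
    refine h.congr' ?_
    filter_upwards [(eventually_ge_atTop 1).prod_inr l] with p hp
    rw [coeff_subst_eq_sum (h0 _), Finset.sum_range_succ', pow_zero, coeff_one,
      if_neg (by omega), mul_zero, add_zero, Finset.mul_sum]
    rw [tsum_eq_sum (s := Finset.range p.2)]
    · exact Finset.sum_congr rfl fun j _ => by ring
    · intro j hj
      rw [Finset.mem_range, not_lt] at hj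
      rw [coeff_pow_eq_zero (h0 _) (by omega), mul_zero, mul_zero]

end UniformTail

end Subst

/-! ### Catalan numbers and the square root -/

/-- If `S` is the Stirling sequence, with limit `√π`, the expression equals `S(2n) / S(n)²` for `n >
0`. -/
theorem tendsto_centralBinom :
    Tendsto (fun n : ℕ => (n.centralBinom : ℝ) * √n / 4 ^ n) atTop (𝓝 (1 / √Real.pi)) := by
  have h1 := Stirling.tendsto_stirlingSeq_sqrt_pi
  have h2 : Tendsto (fun n : ℕ => Stirling.stirlingSeq (2 * n)) atTop (𝓝 √Real.pi) :=
    h1.comp (tendsto_id.const_mul_atTop' two_pos)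
  have hpi : √Real.pi ≠ 0 := by positivity
  have h3 := h2.div (h1.pow 2) (by positivity)
  have e : √Real.pi / √Real.pi ^ 2 = 1 / √Real.pi := by field_simp
  rw [e] at h3
  refine h3.congr' ?_
  filter_upwards [eventually_gt_atTop 0] with n hn
  have hn' : (0 : ℝ) < n := by exact_mod_cast hn
  have hc : (n.centralBinom : ℝ) * ((n.factorial : ℝ) * n.factorial) = (2 * n).factorial := by
    have := Nat.choose_mul_factorial_mul_factorial (show n ≤ 2 * n by omega)
    rw [show 2 * n - n = n by omega, mul_assoc] at this
    rw [Nat.centralBinom]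
    exact_mod_cast this
  simp only [Pi.div_apply, Stirling.stirlingSeq]
  rw [← hc]
  have hf : (n.factorial : ℝ) ≠ 0 := by positivity
  have s1 : √(2 * ((2 * n : ℕ) : ℝ)) = 2 * √n := by
    push_cast
    rw [← mul_assoc, Real.sqrt_mul (by norm_num), show (2 * 2 : ℝ) = 2 ^ 2 by norm_num,
      Real.sqrt_sq (by norm_num)]
  have s2 : √(2 * (n : ℝ)) ^ 2 = 2 * n := Real.sq_sqrt (by positivity)
  have s3 : √(n : ℝ) ^ 2 = n := Real.sq_sqrt (by positivity)
  have s4 : ((2 * n : ℕ) : ℝ) / Real.exp 1 = 2 * (n / Real.exp 1) := by push_cast; ring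
  have s5 : (0 : ℝ) < √n := Real.sqrt_pos.2 hn'
  have s6 : (2 * ((n : ℝ) / Real.exp 1)) ^ (2 * n) = 4 ^ n * ((n / Real.exp 1) ^ n) ^ 2 := by
    rw [pow_mul, mul_pow, mul_pow, pow_right_comm (_ / _)]
    norm_num
  have hp : (n / Real.exp 1) ^ n ≠ 0 := by positivity
  rw [s1, s4, s6, div_pow (n.factorial : ℝ), mul_pow √_, s2]
  generalize (n / Real.exp 1) ^ n = q at *
  field_simp
  rw [s3]

section Quarter

open PowerSeries

variable {α : Type*} {l : Filter α}

/-- The power series `(1 - √(1 - X)) / 2`. -/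
noncomputable def halfOneSubSqrt : ℂ⟦X⟧ :=
  rescale (1 / 4) (X * (catalanSeries.map (Nat.castRingHom ℂ)))

theorem coeff_succ_halfOneSubSqrt (n : ℕ) :
    coeff (n + 1) halfOneSubSqrt = (catalan n : ℂ) / 4 ^ (n + 1) := by
  rw [halfOneSubSqrt, coeff_rescale, coeff_succ_X_mul, coeff_map, catalanSeries_coeff]
  simp
  ring

theorem constantCoeff_halfOneSubSqrt : constantCoeff halfOneSubSqrt = 0 := by
  rw [← coeff_zero_eq_constantCoeff_apply, halfOneSubSqrt, coeff_rescale, coeff_zero_X_mul,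
    mul_zero]

theorem halfOneSubSqrt_eq : halfOneSubSqrt = C (1 / 4) * X + halfOneSubSqrt ^ 2 := by
  have h : X * catalanSeries.map (Nat.castRingHom ℂ) =
      X + (X * catalanSeries.map (Nat.castRingHom ℂ)) ^ 2 := by
    have := congrArg (PowerSeries.map (Nat.castRingHom ℂ)) catalanSeries_sq_mul_X_add_one
    simp only [map_add, map_mul, map_pow, map_X, map_one] at this
    linear_combination (- X : ℂ⟦X⟧) * this
  have h2 := congrArg (rescale (1 / 4 : ℂ)) h
  rwa [map_add, map_pow, rescale_X] at h2

theorem norm_coeff_halfOneSubSqrt_le (n : ℕ) : ‖coeff n halfOneSubSqrt‖ ≤ 1 := by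
  cases n with
  | zero => simp [constantCoeff_halfOneSubSqrt]
  | succ n =>
    rw [coeff_succ_halfOneSubSqrt, norm_div, norm_pow, Complex.norm_natCast, Complex.norm_ofNat,
      div_le_one (by positivity)]
    have h1 : catalan n ≤ 4 ^ n := by
      rw [catalan_eq_centralBinom_div]
      refine (Nat.div_le_self _ _).trans ?_
      rw [Nat.centralBinom, show 4 = 2 ^ 2 from rfl, ← pow_mul]
      exact Nat.choose_le_two_pow _ _
    have h2 : (catalan n : ℝ) ≤ 4 ^ n := by exact_mod_cast h1
    exact h2.trans (pow_le_pow_right₀ (by norm_num) (Nat.le_succ n))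

theorem tendsto_weight_mul_coeff_halfOneSubSqrt :
    Tendsto (fun n => (weight n : ℂ) * coeff n halfOneSubSqrt) atTop
      (𝓝 ((1 / (4 * √Real.pi) : ℝ) : ℂ)) := by
  rw [← tendsto_add_atTop_iff_nat 1]
  have h1 : Tendsto (fun n : ℕ => ((n : ℝ) + 2) / n) atTop (𝓝 1) := by
    have h2 : Tendsto (fun n : ℕ => 1 + (2 : ℝ) / n) atTop (𝓝 (1 + 0)) :=
      (tendsto_const_div_atTop_nhds_zero_nat 2).const_add _
    rw [add_zero] at h2
    refine h2.congr' ?_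
    filter_upwards [eventually_gt_atTop 0] with n hn
    have : (n : ℝ) ≠ 0 := by positivity
    field_simp
  have h3 : Tendsto (fun n : ℕ => ((n : ℝ) + 2) / (n + 1)) atTop (𝓝 1) := by
    have h2 : Tendsto (fun n : ℕ => 1 + 1 / ((n : ℝ) + 1)) atTop (𝓝 (1 + 0)) :=
      tendsto_one_div_add_atTop_nhds_zero_nat.const_add _
    rw [add_zero] at h2
    refine h2.congr fun n => ?_
    field_simp
    ring
  have h4 := ((tendsto_centralBinom.mul (h3.mul h1.sqrt)).div_const 4)
  have e : 1 / √Real.pi * (1 * √1) / 4 = 1 / (4 * √Real.pi) := by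
    rw [Real.sqrt_one]; field_simp
  rw [e] at h4
  refine ((Complex.continuous_ofReal.tendsto _).comp h4).congr' ?_
  filter_upwards [eventually_gt_atTop 0] with n hn
  have hn' : (0 : ℝ) < n := by exact_mod_cast hn
  have hc : (n.centralBinom : ℝ) = (n + 1) * catalan n := by
    exact_mod_cast (succ_mul_catalan_eq_centralBinom n).symm
  have hw : weight (n + 1) = (n + 2) * √(n + 2) := by
    rw [weight, show (3 / 2 : ℝ) = 1 + 1 / 2 by norm_num, Real.rpow_add (by positivity),
      Real.rpow_one, Real.sqrt_eq_rpow]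
    push_cast
    ring_nf
  rw [coeff_succ_halfOneSubSqrt, hw, Function.comp_apply, hc, Real.sqrt_div (by positivity)]
  have : (√(n : ℝ)) ≠ 0 := by positivity
  have e2 : ((n : ℝ) + 1) * catalan n * √n / 4 ^ n * ((n + 2) / (n + 1) * (√(n + 2) / √n)) / 4 =
      (n + 2) * √(n + 2) * (catalan n / 4 ^ (n + 1)) := by
    rw [pow_succ]
    field_simp
  rw [e2]
  push_cast
  ring

theorem UniformTail.const {f : ℂ⟦X⟧} {L : ℂ}
    (h : Tendsto (fun n => (weight n : ℂ) * coeff n f) atTop (𝓝 L)) :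
    UniformTail l (fun _ => f) f L where
  tendsto_coeff _ := tendsto_const_nhds
  tendsto_tail := h.comp tendsto_snd

/-- A singularity outside the unit circle gives geometric decay, hence no contribution at the scale
`n^(-3/2)`. -/
theorem UniformTail.rescale {b : α → ℂ} {b₀ : ℂ} (hb : Tendsto b l (𝓝 b₀)) (hb₀ : ‖b₀‖ < 1)
    {f : ℂ⟦X⟧} (hf : ∀ n, ‖coeff n f‖ ≤ 1) :
    UniformTail l (fun v => PowerSeries.rescale (b v) f) (PowerSeries.rescale b₀ f) 0 where
  tendsto_coeff n := by
    simp only [coeff_rescale]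
    exact (hb.pow n).mul_const _
  tendsto_tail := by
    obtain ⟨r, hr1, hr2⟩ := exists_between hb₀
    have hr0 : 0 ≤ r := (norm_nonneg _).trans hr1.le
    refine squeeze_zero_norm' (a := fun p : α × ℕ => weight p.2 * r ^ p.2) ?_
      ((tendsto_weight_mul_pow hr0 hr2).comp tendsto_snd)
    filter_upwards [(hb.norm.eventually_lt_const hr1).prod_inl atTop] with p hp
    have hw := weight_pos p.2
    rw [coeff_rescale, norm_mul, Complex.norm_real, Real.norm_of_nonneg hw.le, norm_mul, norm_pow]
    have : ‖b p.1‖ ^ p.2 * ‖coeff p.2 f‖ ≤ r ^ p.2 * 1 := by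
      gcongr
      exact hf _
    rw [mul_one] at this
    gcongr

/-- The neighbourhoods are not punctured, so a limit along `𝓝 a` must be the value at `a`. -/
theorem UniformTail.eq_of_nhds [TopologicalSpace α] {a : α} {f : α → ℂ⟦X⟧} {f₀ : ℂ⟦X⟧} {L : ℂ}
    (h : UniformTail (𝓝 a) f f₀ L) : f₀ = f a := by
  ext n
  exact (eq_of_tendsto_nhds (h.tendsto_coeff n)).symm

/-- The difference of the equations is `(f - g)(1 - f - g) = 0`, and the second factor has constant
coefficient `1`. -/
theorem eq_of_quadratic {f g w : ℂ⟦X⟧} (hf : f = w + f ^ 2) (hg : g = w + g ^ 2)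
    (hf0 : constantCoeff f = 0) (hg0 : constantCoeff g = 0) : f = g := by
  have h : (f - g) * (1 - f - g) = 0 := by linear_combination hf - hg
  rcases mul_eq_zero.1 h with h | h
  · exact sub_eq_zero.1 h
  · have := congrArg constantCoeff h
    simp [hf0, hg0] at this

theorem eq_subst_of_quadratic {f w : ℂ⟦X⟧} (hf : f = w + f ^ 2)
    (hf0 : constantCoeff f = 0) (hw0 : constantCoeff w = 0) :
    f = halfOneSubSqrt.subst (C 4 * w) := by
  have h0 : constantCoeff (C 4 * w) = 0 := by simp [hw0]
  have hs : HasSubst (C 4 * w) := .of_constantCoeff_zero' h0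
  refine eq_of_quadratic hf ?_ hf0 ?_
  · conv_lhs => rw [halfOneSubSqrt_eq]
    rw [subst_add hs, subst_mul hs, subst_pow hs, subst_X hs, subst_C]
    have e : (MvPowerSeries.C (1 / 4) : ℂ⟦X⟧) = C (1 / 4) := rfl
    rw [e, ← mul_assoc, ← map_mul]
    norm_num
  · rw [← coeff_zero_eq_constantCoeff_apply, coeff_subst_eq_sum h0]
    simp [constantCoeff_halfOneSubSqrt]

theorem uniformTail_one_sub_two_mul [l.NeBot] {f : α → ℂ⟦X⟧} {f₀ : ℂ⟦X⟧} {L : ℂ}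
    (h : UniformTail l f f₀ L) :
    UniformTail l (fun v => C 1 + C (-2) * f v) (C 1 + C (-2) * f₀) (-2 * L) := by
  have := (UniformTail.C (l := l) (c := fun _ => 1) tendsto_const_nhds).add
    ((UniformTail.C (l := l) (c := fun _ => -2) tendsto_const_nhds).mul h)
  simpa only [evalOne_C, mul_zero, add_zero, zero_add] using this

theorem PowerSeries.rescale_C {R : Type*} [CommSemiring R] (b c : R) :
    PowerSeries.rescale b (C c) = C c := by
  ext n
  rw [coeff_rescale, coeff_C]
  split_ifs with h <;> simp [h]

theorem rescale_oneSubSqrt_sq (b : ℂ) :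
    (C 1 + C (-2) * rescale b halfOneSubSqrt) ^ 2 = 1 - C b * X := by
  have h := congrArg (rescale b) halfOneSubSqrt_eq
  rw [map_add, map_mul, map_pow, rescale_X, rescale_C] at h
  have h2 : (C (-2) : ℂ⟦X⟧) = -2 := by rw [map_neg, map_ofNat]
  have h4 : (4 : ℂ⟦X⟧) * C (1 / 4) = 1 := by
    rw [show (4 : ℂ⟦X⟧) = C 4 from (map_ofNat C 4).symm, ← map_mul]; norm_num
  rw [h2, map_one]
  linear_combination (-4) * h - C b * X * h4

theorem absSummable_C (c : ℂ) : AbsSummable (C c) :=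
  summable_of_ne_finset_zero (s := {0}) fun n hn => by
    rw [Finset.mem_singleton] at hn
    rw [coeff_C, if_neg hn, norm_zero]

theorem absSummable_X : AbsSummable (X : ℂ⟦X⟧) :=
  summable_of_ne_finset_zero (s := {1}) fun n hn => by
    rw [Finset.mem_singleton] at hn
    rw [coeff_X, if_neg hn, norm_zero]

theorem evalOne_one_sub_C_mul_X (b : ℂ) : evalOne (1 - C b * X) = 1 - b := by
  have h : (1 - C b * X : ℂ⟦X⟧) = C 1 + C (-b) * X := by rw [map_one, map_neg]; ring
  rw [h, evalOne_add (absSummable_C _) ((absSummable_C _).mul absSummable_X),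
    evalOne_mul (absSummable_C _) absSummable_X, evalOne_C, evalOne_C, evalOne_X]
  ring

/-- A power series defined by a quadratic equation with discriminant `(1 - X) (1 - (2 ρ - 1) X)`
has coefficients asymptotic to a non-zero multiple of `(n + 1) ^ (- 3 / 2)`. -/
theorem exists_uniformTail_of_quadratic {ρ : ℂ → ℂ} {f : ℂ → ℂ⟦X⟧} {a : ℂ}
    (hρ : ContinuousAt ρ a) (hρ1 : ‖2 * ρ a - 1‖ < 1) (hf0 : ∀ v, constantCoeff (f v) = 0)
    (hf : ∀ᶠ v in 𝓝 a,
      f v = C ((1 - ρ v) ^ 2 / 4) * X ^ 2 + f v ^ 2 + C (ρ v) * X * f v) :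
    ∃ L, L ≠ 0 ∧ UniformTail (𝓝 a) f (f a) L := by
  have hbt : Tendsto (fun v => 2 * ρ v - 1) (𝓝 a) (𝓝 (2 * ρ a - 1)) :=
    (hρ.tendsto.const_mul 2).sub_const 1
  have t1 := uniformTail_one_sub_two_mul (UniformTail.const (l := 𝓝 a)
    tendsto_weight_mul_coeff_halfOneSubSqrt)
  have t2 := uniformTail_one_sub_two_mul
    (UniformTail.rescale hbt hρ1 norm_coeff_halfOneSubSqrt_le)
  have t3 := t1.mul t2
  have hρc : Tendsto (fun v => -ρ v / 2) (𝓝 a) (𝓝 (-ρ a / 2)) :=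
    (hρ.tendsto.neg).div_const 2
  -- This is the explicit root `(1 - ρ X - √(1 - X) √(1 - (2ρ - 1) X)) / 2`; only the factor `√(1 -
  -- X)` has a nonzero tail constant.
  have t4 := ((UniformTail.C (l := 𝓝 a) (c := fun _ => 1 / 2) tendsto_const_nhds).add
    ((UniformTail.C hρc).mul UniformTail.X)).add
    ((UniformTail.C (l := 𝓝 a) (c := fun _ => -1 / 2) tendsto_const_nhds).mul t3)
  set E := C 1 + C (-2) * PowerSeries.rescale (2 * ρ a - 1) halfOneSubSqrt with hE
  have hEs : AbsSummable E := t2.absSummable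
  -- The tail constant of the root is proportional to `E(1)`, and `E(1)² = 1 - (2 ρ a - 1)` is
  -- nonzero.
  have hE1 : evalOne E ≠ 0 := by
    intro h
    have h1 := evalOne_mul hEs hEs
    rw [← sq, rescale_oneSubSqrt_sq, h, mul_zero] at h1
    rw [evalOne_one_sub_C_mul_X, sub_eq_zero] at h1
    rw [← h1, norm_one] at hρ1
    exact lt_irrefl _ hρ1
  have h2 : (C (-2) : ℂ⟦X⟧) = -2 := by rw [map_neg, map_ofNat]
  have h2' : (2 : ℂ⟦X⟧) * C (1 / 2) = 1 := by
    rw [show (2 : ℂ⟦X⟧) = C 2 from (map_ofNat C 2).symm, ← map_mul]; norm_num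
  have key := t4.congr' (g := f) <| hf.mono fun v hv => by
    have e1 : (C ((1 - ρ v) ^ 2 / 4) : ℂ⟦X⟧) = C (1 / 2) ^ 2 * (1 - C (ρ v)) ^ 2 := by
      rw [← map_one C, ← map_sub, ← map_pow, ← map_pow, ← map_mul]
      congr 1
      ring
    have e2 : (C (-ρ v / 2) : ℂ⟦X⟧) = - C (ρ v) * C (1 / 2) := by
      rw [← map_neg, ← map_mul]
      congr 1
      ring
    have e3 : (C (-1 / 2) : ℂ⟦X⟧) = - C (1 / 2) := by
      rw [← map_neg]
      congr 1
      ring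
    have e4 : (C (2 * ρ v - 1) : ℂ⟦X⟧) = 2 * C (ρ v) - 1 := by
      rw [map_sub, map_mul, map_one, map_ofNat]
    have s1 : (C 1 + C (-2) * halfOneSubSqrt) ^ 2 = 1 - X := by
      have := rescale_oneSubSqrt_sq 1
      rwa [rescale_one, RingHom.id_apply, map_one, one_mul] at this
    have s2 := rescale_oneSubSqrt_sq (2 * ρ v - 1)
    have c1 : constantCoeff (C 1 + C (-2) * halfOneSubSqrt) = 1 := by
      simp [constantCoeff_halfOneSubSqrt]
    have c2 : constantCoeff (C 1 + C (-2) *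
        PowerSeries.rescale (2 * ρ v - 1) halfOneSubSqrt) = 1 := by
      rw [map_add, map_mul, ← coeff_zero_eq_constantCoeff_apply (PowerSeries.rescale _ _),
        coeff_rescale]
      simp [constantCoeff_halfOneSubSqrt]
    rw [e4] at s2
    set E₁ := C 1 + C (-2) * halfOneSubSqrt
    set E₂ := C 1 + C (-2) * PowerSeries.rescale (2 * ρ v - 1) halfOneSubSqrt
    -- Completing the square leaves two roots; the wrong sign is excluded because its factor has
    -- constant coefficient `2`.
    have hz : (1 - C (ρ v) * X - 2 * f v - E₁ * E₂) * (1 - C (ρ v) * X - 2 * f v + E₁ * E₂) = 0 := by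
      rw [e1] at hv
      linear_combination (-4) * hv - E₂ ^ 2 * s1 - (1 - X) * s2 +
        ((1 - C (ρ v)) ^ 2 * X ^ 2) * (- 2 * C (1 / 2) - 1) * h2'
    have hz2 : 1 - C (ρ v) * X - 2 * f v + E₁ * E₂ ≠ 0 := fun h => by
      have := congrArg constantCoeff h
      simp [c1, c2, hf0] at this
    have hz3 := (mul_eq_zero.1 hz).resolve_right hz2
    rw [e2, e3]
    linear_combination C (1 / 2) * hz3 + f v * h2'
  have key2 := key.eq_of_nhds
  rw [key2] at key
  refine ⟨_, ?_, key⟩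
  rw [evalOne_C, evalOne_C, evalOne_X]
  have : ((1 / (4 * √Real.pi) : ℝ) : ℂ) ≠ 0 := by
    have : (1 / (4 * √Real.pi) : ℝ) ≠ 0 := by positivity
    exact_mod_cast this
  simpa using ⟨hE1, by simpa using this⟩

end Quarter

/-! ### Generating functions of lambda-terms -/

namespace LambdaTerm

/-- The terms of size `n` with indices at most `k` that are closed under `m` abstractions. -/
def termSet (k m n : ℕ) : Set LambdaTerm :=
  {t | t.ClosedUnder m ∧ t.IndicesLE k ∧ t.size = n}

theorem finite_termSet (k m n : ℕ) : (termSet k m n).Finite :=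
  (finite_indicesLE_size k n).subset fun _ h => ⟨h.2.1, h.2.2.le⟩

/-- The terms of size `n` with indices at most `k` that are closed under `m` abstractions, as a
`Finset`. -/
noncomputable def terms (k m n : ℕ) : Finset LambdaTerm := (finite_termSet k m n).toFinset

theorem mem_terms {k m n : ℕ} {t : LambdaTerm} :
    t ∈ terms k m n ↔ t.ClosedUnder m ∧ t.IndicesLE k ∧ t.size = n := by
  simp [terms, termSet]

/-- The generating polynomial of `terms k m n` with respect to the number of variables. -/
noncomputable def leafPoly (k m n : ℕ) (u : ℂ) : ℂ := ∑ t ∈ terms k m n, u ^ t.numVars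

theorem size_pos (t : LambdaTerm) : 0 < t.size := by cases t <;> simp [size]

theorem leafPoly_zero (k m : ℕ) (u : ℂ) : leafPoly k m 0 u = 0 := by
  refine Finset.sum_eq_zero fun t ht => ?_
  have := (mem_terms.1 ht).2.2
  have := t.size_pos
  omega

open Classical in
theorem terms_succ (k m n : ℕ) :
    terms k m (n + 1) =
      (((if n = 0 then Finset.Icc 1 (min m k) else ∅).image var) ∪
      (((Finset.HasAntidiagonal.antidiagonal n).sigma fun p => terms k m p.1 ×ˢ terms k m p.2).image
        fun x => app x.2.1 x.2.2)) ∪ (terms k (m + 1) n).image abs := by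
  ext t
  simp only [Finset.mem_union, Finset.mem_image, mem_terms, Finset.mem_sigma, Finset.mem_product,
    Finset.HasAntidiagonal.mem_antidiagonal, Sigma.exists, Prod.exists]
  cases t with
  | var i =>
    by_cases hn : n = 0
    · simp [hn, ClosedUnder, IndicesLE, size, and_assoc]
    · simp [hn, ClosedUnder, IndicesLE, size]
  | app s t =>
    simp only [ClosedUnder, IndicesLE, size, add_left_inj, reduceCtorEq, and_false, exists_false,
      false_or, or_false, app.injEq]
    constructor
    · rintro ⟨⟨h1, h2⟩, ⟨h3, h4⟩, h5⟩
      exact ⟨_, _, _, _, ⟨h5, ⟨h1, h3, rfl⟩, h2, h4, rfl⟩, rfl, rfl⟩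
    · rintro ⟨_, _, _, _, ⟨h5, ⟨h1, h3, rfl⟩, h2, h4, rfl⟩, rfl, rfl⟩
      exact ⟨⟨h1, h2⟩, ⟨h3, h4⟩, h5⟩
  | abs t =>
    simp [ClosedUnder, IndicesLE, size]

theorem leafPoly_succ (k m n : ℕ) (u : ℂ) :
    leafPoly k m (n + 1) u = (if n = 0 then (min m k : ℕ) * u else 0) +
      ∑ p ∈ Finset.HasAntidiagonal.antidiagonal n, leafPoly k m p.1 u * leafPoly k m p.2 u +
      leafPoly k (m + 1) n u := by
  classical
  rw [leafPoly, terms_succ, Finset.sum_union, Finset.sum_union, Finset.sum_image, Finset.sum_image,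
    Finset.sum_image, Finset.sum_sigma]
  · congr 2
    · by_cases hn : n = 0 <;> simp [hn, numVars]
    · refine Finset.sum_congr rfl fun p _ => ?_
      rw [leafPoly, leafPoly, Finset.sum_mul_sum, Finset.sum_product]
      simp only [numVars, pow_add]
  · intro s _ t _ h
    exact abs.inj h
  · rintro ⟨⟨a, b⟩, s, t⟩ h ⟨⟨a', b'⟩, s', t'⟩ h' e
    simp only [Finset.coe_sigma, Finset.coe_product, Set.mem_sigma_iff, Set.mem_prod,
      Finset.mem_coe, mem_terms] at h h'
    obtain ⟨-, ⟨-, -, rfl⟩, -, -, rfl⟩ := h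
    obtain ⟨-, ⟨-, -, rfl⟩, -, -, rfl⟩ := h'
    obtain ⟨rfl, rfl⟩ := app.inj e
    rfl
  · intro s _ t _ h
    exact var.inj h
  · rw [Finset.disjoint_left]
    intro t ht ht'
    simp only [Finset.mem_image] at ht ht'
    obtain ⟨_, -, rfl⟩ := ht
    obtain ⟨_, -, h⟩ := ht'
    cases h
  · rw [Finset.disjoint_left]
    intro t ht ht'
    simp only [Finset.mem_image, Finset.mem_union] at ht ht'
    obtain ⟨_, -, rfl⟩ := ht'
    rcases ht with ⟨_, -, h⟩ | ⟨_, -, h⟩ <;> cases h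

/-- Below at least `k` abstractions the index bound already forces every variable to be bound, up to
the condition that indices are positive. This closes the recursion at level `k`. -/
theorem closedUnder_iff_of_indicesLE {k m m' : ℕ} (hm : k ≤ m) (hm' : k ≤ m') {t : LambdaTerm}
    (ht : t.IndicesLE k) : t.ClosedUnder m ↔ t.ClosedUnder m' := by
  induction t generalizing m m' with
  | var i => simp only [ClosedUnder, IndicesLE] at *; omega
  | app s t hs h => exact and_congr (hs hm hm' ht.1) (h hm hm' ht.2)
  | abs t h => exact h (hm.trans m.le_succ) (hm'.trans m'.le_succ) ht

theorem leafPoly_succ_self (k n : ℕ) (u : ℂ) : leafPoly k (k + 1) n u = leafPoly k k n u := by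
  have : terms k (k + 1) n = terms k k n := by
    ext t
    rw [mem_terms, mem_terms]
    exact and_congr_left fun h => closedUnder_iff_of_indicesLE k.le_succ le_rfl h.1
  rw [leafPoly, this, leafPoly]

end LambdaTerm

/-- The pairs with `i + j < N` lie in the square `i, j < N`. -/
theorem sum_range_sum_antidiagonal_le {a : ℕ → ℝ} (ha : ∀ n, 0 ≤ a n) (N : ℕ) :
    ∑ n ∈ Finset.range N, ∑ p ∈ Finset.HasAntidiagonal.antidiagonal n, a p.1 * a p.2 ≤
      (∑ n ∈ Finset.range N, a n) ^ 2 := by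
  simp only [Finset.Nat.sum_antidiagonal_eq_sum_range_succ_mk]
  rw [Finset.sum_range_diag_flip N fun i j => a i * a j, sq, Finset.sum_mul_sum]
  refine Finset.sum_le_sum fun i _ => Finset.sum_le_sum_of_subset_of_nonneg ?_ fun j _ _ =>
    mul_nonneg (ha i) (ha j)
  exact Finset.range_subset_range.2 (Nat.sub_le _ _)

section NormSum

open PowerSeries

/-- The sum of the absolute values of the coefficients. -/
noncomputable def normSum (f : ℂ⟦X⟧) : ℝ := ∑' n, ‖coeff n f‖

theorem normSum_add_le {f g : ℂ⟦X⟧} (hf : AbsSummable f) (hg : AbsSummable g) :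
    normSum (f + g) ≤ normSum f + normSum g := by
  have hf' : Summable fun n => ‖coeff n f‖ := hf
  have hg' : Summable fun n => ‖coeff n g‖ := hg
  unfold normSum
  rw [← hf'.tsum_add hg']
  have h : ∀ n, ‖coeff n (f + g)‖ ≤ ‖coeff n f‖ + ‖coeff n g‖ := fun n => by
    rw [map_add]; exact norm_add_le _ _
  exact (Summable.of_nonneg_of_le (fun _ => norm_nonneg _) h (hf'.add hg')).tsum_le_tsum h
    (hf'.add hg')

theorem normSum_C_mul_X_pow_mul (c : ℂ) (j : ℕ) (f : ℂ⟦X⟧) :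
    normSum (C c * X ^ j * f) = ‖c‖ * normSum f := by
  unfold normSum
  rw [← tsum_mul_left]
  rw [← (add_left_injective j).tsum_eq (f := fun n => ‖coeff n (C c * X ^ j * f)‖)]
  · refine tsum_congr fun n => ?_
    simp only [mul_assoc, coeff_C_mul, norm_mul, coeff_X_pow_mul]
  · intro n hn
    by_contra h
    refine hn ?_
    have : n < j := by
      by_contra h'
      exact h ⟨n - j, by simp only; omega⟩
    simp only [mul_assoc, coeff_C_mul, coeff_X_pow_mul', if_neg (not_le.2 this), mul_zero,
      norm_zero]

theorem normSum_one : normSum 1 = 1 := by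
  unfold normSum
  rw [tsum_eq_single 0 fun n hn => by simp [coeff_one, hn]]
  simp

end NormSum

/-! ### Uniform coefficient asymptotics for the generating functions -/

section ScaledGF

open PowerSeries
open LambdaTerm (leafPoly leafPoly_zero leafPoly_succ leafPoly_succ_self)

/-- The dominant singularity `1 / (1 + 2 √(k u))`, as a function of `v = √u`. -/
noncomputable def singularity (k : ℕ) (v : ℂ) : ℂ := (1 + 2 * (√(k : ℝ) : ℝ) * v)⁻¹

/-- The generating function of the terms closed under `m` abstractions, marked by `v ^ 2` at each
leaf, shifted by one and scaled such that the dominant singularity is `1`. -/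
noncomputable def scaledGF (k m : ℕ) (v : ℂ) : ℂ⟦X⟧ :=
  rescale (singularity k v) (X * PowerSeries.mk fun n => leafPoly k m n (v ^ 2))

theorem coeff_succ_scaledGF (k m n : ℕ) (v : ℂ) :
    coeff (n + 1) (scaledGF k m v) = singularity k v ^ (n + 1) * leafPoly k m n (v ^ 2) := by
  rw [scaledGF, coeff_rescale, coeff_succ_X_mul, coeff_mk]

theorem constantCoeff_scaledGF (k m : ℕ) (v : ℂ) : constantCoeff (scaledGF k m v) = 0 := by
  rw [← coeff_zero_eq_constantCoeff_apply, scaledGF, coeff_rescale, coeff_zero_X_mul, mul_zero]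

/-- Thanks to the shift by `X`, the recursion takes the form `f = w + f²` treated by
`eq_subst_of_quadratic`. -/
theorem scaledGF_eq (k m : ℕ) (v : ℂ) :
    scaledGF k m v = C ((singularity k v) ^ 2 * ((min m k : ℕ) * v ^ 2)) * X ^ 2 +
      C (singularity k v) * X * scaledGF k (m + 1) v + scaledGF k m v ^ 2 := by
  set u := v ^ 2
  set F : ℕ → ℂ⟦X⟧ := fun m => PowerSeries.mk fun n => leafPoly k m n u
  have hF : F m = C ((min m k : ℕ) * u) * X + X * F m ^ 2 + X * F (m + 1) := by
    ext n
    cases n with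
    | zero => simp [F, leafPoly_zero]
    | succ n =>
      rw [map_add, map_add, coeff_succ_X_mul, coeff_succ_X_mul, coeff_C_mul, sq,
        coeff_mul, coeff_X]
      simp only [F, coeff_mk, leafPoly_succ]
      by_cases hn : n = 0 <;> simp [hn]
  have h : X * F m = C ((min m k : ℕ) * u) * X ^ 2 + X * (X * F (m + 1)) + (X * F m) ^ 2 := by
    linear_combination X * hF
  have h2 := congrArg (rescale (singularity k v)) h
  rw [map_add, map_add, map_mul _ (C _), map_pow, map_pow, map_mul _ X (X * _), rescale_X,
    rescale_C] at h2
  rw [map_mul C, map_pow C]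
  unfold scaledGF
  linear_combination h2

theorem scaledGF_succ_self (k : ℕ) (v : ℂ) : scaledGF k (k + 1) v = scaledGF k k v := by
  simp only [scaledGF, leafPoly_succ_self]

theorem one_add_two_sqrt_pos (k : ℕ) : 0 < 1 + 2 * √(k : ℝ) := by positivity

theorem singularity_one (k : ℕ) : singularity k 1 = ((1 + 2 * √(k : ℝ))⁻¹ : ℝ) := by
  simp [singularity]

theorem one_add_ne_zero (k : ℕ) : (1 + 2 * (√(k : ℝ) : ℝ) * 1 : ℂ) ≠ 0 := by
  have := (one_add_two_sqrt_pos k).ne'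
  rw [mul_one]
  exact_mod_cast this

theorem continuousAt_singularity (k : ℕ) : ContinuousAt (singularity k) 1 :=
  ContinuousAt.inv₀ (by fun_prop) (one_add_ne_zero k)

/-- With `r = 1 / (1 + 2 √k)`, the number `√k` is a fixed point of `s ↦ r (k + s² + s)`, and the
recursion bounds the partial sums by this map. The induction runs over all `m` together because
level `m` calls level `m + 1`. -/
theorem sum_norm_coeff_scaledGF_one_le (k N : ℕ) (m : ℕ) :
    ∑ n ∈ Finset.range N, ‖leafPoly k m n 1‖ * ((1 + 2 * √(k : ℝ))⁻¹) ^ n ≤ √(k : ℝ) := by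
  set r := (1 + 2 * √(k : ℝ))⁻¹ with hr
  have hr0 : 0 < r := inv_pos.2 (one_add_two_sqrt_pos k)
  have hr1 : r * (1 + 2 * √(k : ℝ)) = 1 := inv_mul_cancel₀ (one_add_two_sqrt_pos k).ne'
  have hk : √(k : ℝ) ^ 2 = k := Real.sq_sqrt (Nat.cast_nonneg k)
  induction N generalizing m with
  | zero => simp
  | succ N ih =>
    set b : ℕ → ℕ → ℝ := fun m n => ‖leafPoly k m n 1‖ * r ^ n with hb
    have hb0 : ∀ m n, 0 ≤ b m n := fun m n => by positivity
    have step : ∀ n, b m (n + 1) ≤ r * ((if n = 0 then (k : ℝ) else 0) +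
        ∑ p ∈ Finset.HasAntidiagonal.antidiagonal n, b m p.1 * b m p.2 + b (m + 1) n) := by
      intro n
      have h1 : ‖leafPoly k m (n + 1) 1‖ ≤ (if n = 0 then (k : ℝ) else 0) +
          ∑ p ∈ Finset.HasAntidiagonal.antidiagonal n, ‖leafPoly k m p.1 1‖ * ‖leafPoly k m p.2 1‖ +
          ‖leafPoly k (m + 1) n 1‖ := by
        rw [leafPoly_succ]
        refine (norm_add₃_le ..).trans ?_
        gcongr ?_ + ?_ + _
        · by_cases hn : n = 0
          · simp only [hn, if_true, mul_one, Complex.norm_natCast]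
            exact_mod_cast min_le_right m k
          · simp [hn]
        · exact (norm_sum_le _ _).trans_eq (by simp)
      have h2 : (if n = 0 then (k : ℝ) else 0) = (if n = 0 then (k : ℝ) else 0) * r ^ n := by
        by_cases hn : n = 0 <;> simp [hn]
      have h3 : ∑ p ∈ Finset.HasAntidiagonal.antidiagonal n, b m p.1 * b m p.2 =
          (∑ p ∈ Finset.HasAntidiagonal.antidiagonal n,
            ‖leafPoly k m p.1 1‖ * ‖leafPoly k m p.2 1‖) * r ^ n := by
        rw [Finset.sum_mul]
        refine Finset.sum_congr rfl fun p hp => ?_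
        rw [← Finset.HasAntidiagonal.mem_antidiagonal.1 hp, pow_add]
        simp only [hb]
        ring
      rw [h2, h3]
      calc b m (n + 1) = ‖leafPoly k m (n + 1) 1‖ * r ^ (n + 1) := rfl
        _ ≤ _ * r ^ (n + 1) := mul_le_mul_of_nonneg_right h1 (by positivity)
        _ = _ := by simp only [hb]; ring
    have h0 : b m 0 = 0 := by simp [hb, leafPoly_zero]
    have ih1 := ih m
    have ih2 := ih (m + 1)
    have hs0 : 0 ≤ ∑ n ∈ Finset.range N, b m n := Finset.sum_nonneg fun n _ => hb0 m n
    rw [Finset.sum_range_succ', show ‖leafPoly k m 0 1‖ * r ^ 0 = 0 from h0, add_zero]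
    calc ∑ n ∈ Finset.range N, b m (n + 1) ≤ _ := Finset.sum_le_sum fun n _ => step n
      _ = r * ((∑ n ∈ Finset.range N, if n = 0 then (k : ℝ) else 0) +
          (∑ n ∈ Finset.range N, ∑ p ∈ Finset.HasAntidiagonal.antidiagonal n, b m p.1 * b m p.2) +
          ∑ n ∈ Finset.range N, b (m + 1) n) := by
        rw [← Finset.mul_sum, Finset.sum_add_distrib, Finset.sum_add_distrib]
      _ ≤ r * (√(k : ℝ) ^ 2 + √(k : ℝ) ^ 2 + √(k : ℝ)) := by
        refine mul_le_mul_of_nonneg_left (add_le_add (add_le_add ?_ ?_) ih2) hr0.le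
        · rw [hk, Finset.sum_ite_eq']
          split_ifs <;> simp
        · exact (sum_range_sum_antidiagonal_le (hb0 m) N).trans (pow_le_pow_left₀ hs0 ih1 2)
      _ = √(k : ℝ) * (r * (1 + 2 * √(k : ℝ))) := by ring
      _ = √(k : ℝ) := by rw [hr1, mul_one]

theorem absSummable_scaledGF_one (k m : ℕ) : AbsSummable (scaledGF k m 1) ∧
    normSum (scaledGF k m 1) ≤ (1 + 2 * √(k : ℝ))⁻¹ * √(k : ℝ) := by
  set r := (1 + 2 * √(k : ℝ))⁻¹ with hr
  have hr0 : 0 < r := inv_pos.2 (one_add_two_sqrt_pos k)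
  have h : ∀ N, ∑ n ∈ Finset.range N, ‖coeff n (scaledGF k m 1)‖ ≤ r * √(k : ℝ) := by
    intro N
    cases N with
    | zero => simp only [Finset.range_zero, Finset.sum_empty]; positivity
    | succ N =>
      rw [Finset.sum_range_succ', coeff_zero_eq_constantCoeff_apply, constantCoeff_scaledGF,
        norm_zero, add_zero]
      refine le_trans (le_of_eq ?_) (mul_le_mul_of_nonneg_left
        (sum_norm_coeff_scaledGF_one_le k N m) hr0.le)
      rw [Finset.mul_sum]
      refine Finset.sum_congr rfl fun n _ => ?_
      rw [coeff_succ_scaledGF, singularity_one, norm_mul, norm_pow, Complex.norm_real,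
        Real.norm_of_nonneg hr0.le, one_pow]
      ring
  exact ⟨summable_of_sum_range_le (fun _ => norm_nonneg _) h,
    Real.tsum_le_of_sum_range_le (fun _ => norm_nonneg _) h⟩

/-- At level `k` the equation involves one series only. As `1 - ρ = 2 ρ √k v`, its discriminant is
`(1 - ρ X)² - (1 - ρ)² X² = (1 - X)(1 - (2ρ - 1) X)`. -/
theorem exists_uniformTail_scaledGF_self {k : ℕ} (hk : 1 ≤ k) :
    ∃ L, L ≠ 0 ∧ UniformTail (𝓝 1) (scaledGF k k) (scaledGF k k 1) L := by
  refine exists_uniformTail_of_quadratic (continuousAt_singularity k) ?_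
    (constantCoeff_scaledGF k k) ?_
  · have hs : 0 < √(k : ℝ) := Real.sqrt_pos.2 (by exact_mod_cast hk)
    rw [singularity_one]
    have h : (2 * ((1 + 2 * √(k : ℝ))⁻¹ : ℝ) - 1 : ℂ) = ((2 * (1 + 2 * √(k : ℝ))⁻¹ - 1 : ℝ) : ℂ) := by
      push_cast; ring
    rw [h, Complex.norm_real, Real.norm_eq_abs, abs_lt]
    have h1 : 0 < (1 + 2 * √(k : ℝ))⁻¹ := inv_pos.2 (one_add_two_sqrt_pos k)
    have h2 : (1 + 2 * √(k : ℝ))⁻¹ < 1 := inv_lt_one_of_one_lt₀ (by linarith)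
    constructor <;> linarith
  · have hc : ContinuousAt (fun v : ℂ => 1 + 2 * ((√(k : ℝ) : ℝ) : ℂ) * v) 1 := by fun_prop
    filter_upwards [hc.eventually_ne (one_add_ne_zero k)] with v hv
    have h := scaledGF_eq k k v
    rw [scaledGF_succ_self] at h
    have e : (1 - singularity k v) ^ 2 / 4 =
        singularity k v ^ 2 * ((min k k : ℕ) * v ^ 2) := by
      have hk2 : (k : ℂ) = ((√(k : ℝ) : ℝ) : ℂ) ^ 2 := by
        rw [← Complex.ofReal_pow, Real.sq_sqrt (Nat.cast_nonneg k), Complex.ofReal_natCast]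
      rw [min_self, hk2, singularity]
      field_simp
      ring
    rw [e]
    linear_combination h

/-- Level `m` is a composition of `halfOneSubSqrt` with `4 W`, where `W` carries the tail of level
`m + 1`. The absolute sum of `4 W` at `v = 1` stays below `1`, the radius of convergence of the
outer series, so the singularity of level `m + 1` is transmitted. -/
theorem exists_uniformTail_scaledGF_of_succ {k m : ℕ} (hm : m ≤ k)
    (h : ∃ L, L ≠ 0 ∧ UniformTail (𝓝 1) (scaledGF k (m + 1)) (scaledGF k (m + 1) 1) L) :
    ∃ L, L ≠ 0 ∧ UniformTail (𝓝 1) (scaledGF k m) (scaledGF k m 1) L := by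
  obtain ⟨L, hL, hU⟩ := h
  have hρ := (continuousAt_singularity k).tendsto
  have hκ : Tendsto (fun v => singularity k v ^ 2 * ((min m k : ℕ) * v ^ 2)) (𝓝 1)
      (𝓝 (singularity k 1 ^ 2 * ((min m k : ℕ) * 1 ^ 2))) :=
    (hρ.pow 2).mul ((tendsto_id.pow 2).const_mul _)
  have tX : UniformTail (𝓝 (1 : ℂ)) (fun _ => (X : ℂ⟦X⟧)) X 0 := .X
  have hW := ((UniformTail.C hκ).mul (tX.mul tX)).add (((UniformTail.C hρ).mul tX).mul hU)
  simp only [← sq] at hW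
  set W : ℂ → ℂ⟦X⟧ := fun v => C (singularity k v ^ 2 * ((min m k : ℕ) * v ^ 2)) * X ^ 2 +
    C (singularity k v) * X * scaledGF k (m + 1) v with hWdef
  have hW0 : ∀ v, constantCoeff (W v) = 0 := fun v => by simp [hWdef]
  have h4W := (UniformTail.C (l := 𝓝 (1 : ℂ)) (c := fun _ => 4) tendsto_const_nhds).mul hW
  have hsum : normSum (C 4 * W 1) < 1 := by
    set r := (1 + 2 * √(k : ℝ))⁻¹ with hr
    have hr0 : 0 < r := inv_pos.2 (one_add_two_sqrt_pos k)
    have hr1 : r * (1 + 2 * √(k : ℝ)) = 1 := inv_mul_cancel₀ (one_add_two_sqrt_pos k).ne'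
    have hk : √(k : ℝ) ^ 2 = k := Real.sq_sqrt (Nat.cast_nonneg k)
    have a1 : AbsSummable (X ^ 2 : ℂ⟦X⟧) := by rw [sq]; exact absSummable_X.mul absSummable_X
    obtain ⟨a2, a3⟩ := absSummable_scaledGF_one k (m + 1)
    have n1 : normSum (W 1) ≤ r ^ 2 * m + r * (r * √(k : ℝ)) := by
      refine (normSum_add_le ((absSummable_C _).mul a1)
        (((absSummable_C _).mul absSummable_X).mul a2)).trans (add_le_add (le_of_eq ?_) ?_)
      · have := normSum_C_mul_X_pow_mul (singularity k 1 ^ 2 * ((min m k : ℕ) * 1 ^ 2)) 2 1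
        rw [mul_one] at this
        rw [this, normSum_one, singularity_one, norm_mul, norm_pow, Complex.norm_real,
          Real.norm_of_nonneg hr0.le, min_eq_left hm]
        simp
      · have := normSum_C_mul_X_pow_mul (singularity k 1) 1 (scaledGF k (m + 1) 1)
        rw [pow_one] at this
        rw [this, singularity_one, Complex.norm_real, Real.norm_of_nonneg hr0.le]
        gcongr
    have n2 := normSum_C_mul_X_pow_mul 4 0 (W 1)
    rw [pow_zero, mul_one, Complex.norm_ofNat] at n2
    have hm' : (m : ℝ) ≤ √(k : ℝ) ^ 2 := by rw [hk]; exact_mod_cast hm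
    rw [n2]
    -- The bound equals `1 - r²`, since `4k + 4√k = (1 + 2√k)² - 1`.
    calc 4 * normSum (W 1) ≤ 4 * (r ^ 2 * √(k : ℝ) ^ 2 + r * (r * √(k : ℝ))) := by
          refine mul_le_mul_of_nonneg_left (n1.trans ?_) (by norm_num)
          gcongr
      _ = (r * (1 + 2 * √(k : ℝ))) ^ 2 - r ^ 2 := by ring
      _ < 1 := by rw [hr1]; have := pow_pos hr0 2; linarith
  obtain ⟨M, hM⟩ := h4W.subst (fun v => by rw [map_mul, hW0, mul_zero]) hsum
    norm_coeff_halfOneSubSqrt_le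
  have hM' : UniformTail (𝓝 1) (scaledGF k m) _ M := hM.congr' <| .of_forall fun v =>
    (eq_subst_of_quadratic (scaledGF_eq k m v) (constantCoeff_scaledGF k m v) (hW0 v)).symm
  have e := hM'.eq_of_nhds
  rw [e] at hM'
  refine ⟨M, fun hM0 => hL ?_, hM'⟩
  -- Comparing tail constants in `f = W + f²`: if that of `f` vanished, so would that of `W`, which
  -- is `ρ(1) L`.
  have h3 := (hW.add (hM'.mul hM')).congr' (g := scaledGF k m) <| .of_forall fun v => by
    rw [← sq]; exact (scaledGF_eq k m v).symm
  have h5 := hM'.tail_unique (h3.eq_of_nhds ▸ h3)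
  rw [evalOne_mul (absSummable_C _) absSummable_X, evalOne_C, evalOne_X] at h5
  have hs : singularity k 1 ≠ 0 := inv_ne_zero (one_add_ne_zero k)
  simpa [hM0, hs, evalOne_C] using h5

theorem exists_uniformTail_scaledGF {k : ℕ} (hk : 1 ≤ k) :
    ∃ L, L ≠ 0 ∧ UniformTail (𝓝 1) (scaledGF k 0) (scaledGF k 0 1) L :=
  Nat.decreasingInduction
    (motive := fun m _ => ∃ L, L ≠ 0 ∧ UniformTail (𝓝 1) (scaledGF k m) (scaledGF k m 1) L)
    (fun _ hm h => exists_uniformTail_scaledGF_of_succ hm.le h)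
    (exists_uniformTail_scaledGF_self hk) (Nat.zero_le k)

end ScaledGF

/-! ### Convergence of moment generating functions -/

theorem tendsto_one_add_pow_exp {β : Type*} {l : Filter β} {N : β → ℕ} {y : β → ℂ} {t : ℂ}
    (hy : Tendsto y l (𝓝 0)) (hN : Tendsto (fun b => (N b : ℂ) * y b) l (𝓝 t)) :
    Tendsto (fun b => (1 + y b) ^ N b) l (𝓝 (Complex.exp t)) := by
  have h1 : (fun z : ℂ => Complex.log (1 + z) - z) =o[𝓝 0] fun z => z := by
    have := (Complex.hasDerivAt_log Complex.one_mem_slitPlane).isLittleO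
    have h2 := this.comp_tendsto (k := fun z : ℂ => 1 + z) (l' := 𝓝 0)
      (by simpa using (tendsto_id (x := 𝓝 (0 : ℂ))).const_add 1)
    refine (h2.congr (fun z => ?_) fun z => ?_) <;> simp
  have h2 : (fun b => (N b : ℂ) * (Complex.log (1 + y b) - y b)) =o[l]
      fun b => (N b : ℂ) * y b :=
    (isBigO_refl (fun b => (N b : ℂ)) l).mul_isLittleO (h1.comp_tendsto hy)
  have h3 : Tendsto (fun b => (N b : ℂ) * (Complex.log (1 + y b) - y b)) l (𝓝 0) :=
    (isLittleO_one_iff ℂ).1 (h2.trans_isBigO (hN.isBigO_one ℂ))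
  have h4 := (h3.add hN).cexp
  rw [zero_add] at h4
  refine h4.congr' ?_
  have h5 : ∀ᶠ b in l, 1 + y b ≠ 0 := by
    have : Tendsto (fun b => 1 + y b) l (𝓝 (1 + 0)) := hy.const_add 1
    exact this.eventually_ne (by simp)
  filter_upwards [h5] with b hb
  rw [← mul_add, sub_add_cancel, Complex.exp_nat_mul, Complex.exp_log hb]

/-- For real `α` in `[0, 1]` the product is the moment generating function of half a Bernoulli
variable, centred at its mean `α / 2`. The linear term cancels, and half of the variance `α (1 - α)
/ 4` remains. -/
theorem exp_mixture_isLittleO (α : ℂ) :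
    (fun h : ℂ => (1 - α + α * Complex.exp (h / 2)) * Complex.exp (-(α / 2) * h) - 1 -
      α * (1 - α) / 8 * h ^ 2) =o[𝓝 0] fun h => h ^ 2 := by
  have key : ∀ c : ℂ, (fun h : ℂ => Complex.exp (c * h) - (1 + c * h + (c * h) ^ 2 / 2))
      =o[𝓝 0] fun h => h ^ 2 := by
    intro c
    have h1 := (Complex.exp_sub_sum_range_succ_isLittleO_pow 2).comp_tendsto
      (k := fun h : ℂ => c * h) (l' := 𝓝 0) (by simpa using (tendsto_id (x := 𝓝 (0 : ℂ))).const_mul c)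
    have h2 : ((fun x : ℂ => x ^ 2) ∘ fun h => c * h) =O[𝓝 0] fun h : ℂ => h ^ 2 := by
      simp only [Function.comp_def, mul_pow]
      exact isBigO_const_mul_self _ _ _
    refine (h1.trans_isBigO h2).congr_left fun h => ?_
    simp [Finset.sum_range_succ]
  have h1 := ((key (-(α / 2))).const_mul_left (1 - α)).add ((key (1 / 2 - α / 2)).const_mul_left α)
  refine h1.congr_left fun h => ?_
  have e : Complex.exp ((1 / 2 - α / 2) * h) =
      Complex.exp (h / 2) * Complex.exp (-(α / 2) * h) := by
    rw [← Complex.exp_add]; ring_nf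
  rw [e]
  ring

theorem tendsto_exp_mixture_pow {β : Type*} {l : Filter β} {N : β → ℕ} {s : β → ℂ} {s₀ α : ℂ}
    (hN : Tendsto N l atTop) (hs : Tendsto s l (𝓝 s₀)) :
    Tendsto (fun b => ((1 - α + α * Complex.exp (s b / (√(N b : ℝ) : ℝ) / 2)) *
      Complex.exp (-(α / 2) * (s b / (√(N b : ℝ) : ℝ)))) ^ N b) l
      (𝓝 (Complex.exp (α * (1 - α) / 8 * s₀ ^ 2))) ∧
    Tendsto (fun b => s b / (√(N b : ℝ) : ℝ)) l (𝓝 0) := by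
  have hsq : Tendsto (fun b => √(N b : ℝ)) l atTop :=
    Real.tendsto_sqrt_atTop.comp (tendsto_natCast_atTop_atTop.comp hN)
  have hinv : Tendsto (fun b => (((√(N b : ℝ))⁻¹ : ℝ) : ℂ)) l (𝓝 ((0 : ℝ) : ℂ)) :=
    (Complex.continuous_ofReal.tendsto 0).comp (tendsto_inv_atTop_zero.comp hsq)
  have hh : Tendsto (fun b => s b / (√(N b : ℝ) : ℝ)) l (𝓝 0) := by
    have := hs.mul hinv
    simpa [div_eq_mul_inv] using this
  refine ⟨?_, hh⟩
  have ho := (exp_mixture_isLittleO α).comp_tendsto hh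
  have hNs : ∀ᶠ b in l, (N b : ℂ) * (s b / (√(N b : ℝ) : ℝ)) ^ 2 = s b ^ 2 := by
    filter_upwards [hN.eventually_gt_atTop 0] with b hb
    have h1 : ((√(N b : ℝ) : ℝ) : ℂ) ^ 2 = N b := by
      rw [← Complex.ofReal_pow, Real.sq_sqrt (Nat.cast_nonneg _), Complex.ofReal_natCast]
    have h2 : (N b : ℂ) ≠ 0 := by exact_mod_cast hb.ne'
    rw [div_pow, h1]
    field_simp
  have hsq : Tendsto (fun b => (N b : ℂ) * (s b / (√(N b : ℝ) : ℝ)) ^ 2) l (𝓝 (s₀ ^ 2)) :=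
    (hs.pow 2).congr' (hNs.mono fun b hb => hb.symm)
  have ho2 := (isBigO_refl (fun b => (N b : ℂ)) l).mul_isLittleO ho
  have ho3 := (isLittleO_one_iff ℂ).1 (ho2.trans_isBigO (hsq.isBigO_one ℂ))
  have h1 := ho3.add (hsq.const_mul (α * (1 - α) / 8))
  rw [zero_add] at h1
  have hy : Tendsto (fun b => (1 - α + α * Complex.exp (s b / (√(N b : ℝ) : ℝ) / 2)) *
      Complex.exp (-(α / 2) * (s b / (√(N b : ℝ) : ℝ))) - 1) l (𝓝 0) := by
    have hc : Continuous fun h : ℂ =>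
        (1 - α + α * Complex.exp (h / 2)) * Complex.exp (-(α / 2) * h) - 1 := by fun_prop
    have := (hc.tendsto 0).comp hh
    simpa [Function.comp_def] using this
  refine (tendsto_one_add_pow_exp (N := N) hy (h1.congr fun b => ?_)).congr fun b => ?_
  · simp only [Function.comp_apply]; ring
  · rw [add_sub_cancel]

/-! ### Quasi-powers and convergence of moments -/

section MGF

open LambdaTerm (leafPoly terms mem_terms numVars)

/-- The ratio `2 √k / (1 + 2 √k)`. -/
noncomputable def leafRate (k : ℕ) : ℝ := 2 * √(k : ℝ) / (1 + 2 * √(k : ℝ))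

/-- The deviation of the number of variables of `t` from `n * leafRate k / 2`, divided by `√n`. -/
noncomputable def deviation (k n : ℕ) (t : LambdaTerm) : ℝ :=
  ((t.numVars : ℝ) - leafRate k / 2 * n) / √(n : ℝ)

/-- The moment generating function of `deviation k n` on random closed terms. -/
noncomputable def deviationMGF (k n : ℕ) (s : ℂ) : ℂ :=
  (∑ t ∈ terms k 0 n, Complex.exp (s * deviation k n t)) / (terms k 0 n).card

theorem leafPoly_one (k m n : ℕ) : leafPoly k m n 1 = (terms k m n).card := by
  simp [leafPoly]

theorem deviationMGF_eq {k n : ℕ} (hn : 0 < n) (s : ℂ) :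
    deviationMGF k n s = Complex.exp (-(leafRate k / 2) * (s / (√(n : ℝ) : ℝ))) ^ n *
      (leafPoly k 0 n (Complex.exp (s / (√(n : ℝ) : ℝ) / 2) ^ 2) / leafPoly k 0 n 1) := by
  have hn' : ((√(n : ℝ) : ℝ) : ℂ) ≠ 0 := by
    have : √(n : ℝ) ≠ 0 := by positivity
    exact_mod_cast this
  rw [deviationMGF, leafPoly_one, mul_div_assoc', leafPoly, Finset.mul_sum]
  congr 1
  refine Finset.sum_congr rfl fun t _ => ?_
  rw [← Complex.exp_nat_mul, ← Complex.exp_nat_mul, ← Complex.exp_nat_mul, ← Complex.exp_add]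
  congr 1
  rw [deviation]
  push_cast
  field_simp
  ring

/-- The scaled coefficients at `v` and at `1` have the same tail constant `L ≠ 0`, so their ratio
tends to `1` and only `(ρ(1) / ρ(v))^(N+1)` matters. A general filter covers both sequences and
joint limits in `n` and `s`. -/
theorem tendsto_deviationMGF {k : ℕ} (hk : 1 ≤ k) {β : Type*} {l : Filter β} {N : β → ℕ}
    {s : β → ℂ} {s₀ : ℂ} (hN : Tendsto N l atTop) (hs : Tendsto s l (𝓝 s₀)) :
    Tendsto (fun b => deviationMGF k (N b) (s b)) l
      (𝓝 (Complex.exp (leafRate k * (1 - leafRate k) / 8 * s₀ ^ 2))) := by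
  obtain ⟨h1, h2⟩ := tendsto_exp_mixture_pow (α := leafRate k) hN hs
  set v : β → ℂ := fun b => Complex.exp (s b / (√(N b : ℝ) : ℝ) / 2) with hv
  have hv1 : Tendsto v l (𝓝 1) := by
    have hc : Continuous fun h : ℂ => Complex.exp (h / 2) := by fun_prop
    have := (hc.tendsto 0).comp h2
    simpa [Function.comp_def] using this
  obtain ⟨L, hL, hU⟩ := exists_uniformTail_scaledGF hk
  have hN1 : Tendsto (fun b => N b + 1) l atTop := (tendsto_add_atTop_nat 1).comp hN
  have h3 := hU.tendsto_tail.comp (hv1.prodMk hN1)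
  have h4 := hU.tendsto_tail.comp ((tendsto_const_nhds (x := (1 : ℂ)) (f := l)).prodMk hN1)
  have hρ := (continuousAt_singularity k).tendsto.comp hv1
  have hρ1 : singularity k 1 ≠ 0 := inv_ne_zero (one_add_ne_zero k)
  -- The single factor `ρ(1) / ρ(v)`, which tends to `1`, comes from the index shift: `leafPoly` at
  -- `N` sits in coefficient `N + 1`.
  have h5 := (h1.mul ((tendsto_const_nhds (x := singularity k 1)).div hρ hρ1)).mul (h3.div h4 hL)
  rw [div_self hρ1, div_self hL, mul_one, mul_one] at h5
  refine h5.congr' ?_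
  filter_upwards [hN.eventually_gt_atTop 0, hρ.eventually_ne hρ1, h4.eventually_ne hL] with b hb hρb h4b
  simp only [Function.comp_apply] at hρb h4b
  have hw : (weight (N b + 1) : ℂ) ≠ 0 := by exact_mod_cast (weight_pos _).ne'
  rw [coeff_succ_scaledGF, one_pow] at h4b
  have hp1 : leafPoly k 0 (N b) 1 ≠ 0 := right_ne_zero_of_mul (right_ne_zero_of_mul h4b)
  rw [deviationMGF_eq hb]
  simp only [Function.comp_apply, Pi.div_apply, coeff_succ_scaledGF, one_pow]
  have e : (1 - leafRate k + leafRate k * v b : ℂ) = singularity k 1 / singularity k (v b) := by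
    have h0 := one_add_ne_zero k
    rw [mul_one] at h0
    rw [singularity, singularity, leafRate, div_inv_eq_mul, mul_one]
    push_cast
    field_simp
    ring
  rw [show Complex.exp (s b / (√(N b : ℝ) : ℝ) / 2) = v b from rfl, e, mul_pow, div_pow]
  field_simp
  ring

/-- Convergence as `n → ∞` and `s → s₀` jointly, with a continuous limit, amounts to locally uniform
convergence. -/
theorem tendstoLocallyUniformlyOn_deviationMGF {k : ℕ} (hk : 1 ≤ k) :
    TendstoLocallyUniformlyOn (deviationMGF k)
      (fun s => Complex.exp (leafRate k * (1 - leafRate k) / 8 * s ^ 2)) atTop Set.univ := by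
  rw [tendstoLocallyUniformlyOn_iff_forall_tendsto]
  intro s₀ _
  rw [nhdsWithin_univ]
  have h1 := tendsto_deviationMGF hk (l := atTop ×ˢ 𝓝 s₀) (N := Prod.fst) (s := Prod.snd)
    tendsto_fst tendsto_snd
  have hc : Continuous fun s : ℂ => Complex.exp (leafRate k * (1 - leafRate k) / 8 * s ^ 2) := by
    fun_prop
  have h2 := (hc.tendsto s₀).comp (tendsto_snd (f := (atTop : Filter ℕ)) (g := 𝓝 s₀))
  exact (h2.prodMk_nhds h1).mono_right (nhds_le_uniformity _)

theorem hasDerivAt_sum_exp (k n j : ℕ) (s : ℂ) :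
    HasDerivAt (fun s : ℂ => (∑ t ∈ terms k 0 n,
        (deviation k n t : ℂ) ^ j * Complex.exp (s * deviation k n t)) / (terms k 0 n).card)
      ((∑ t ∈ terms k 0 n,
        (deviation k n t : ℂ) ^ (j + 1) * Complex.exp (s * deviation k n t)) /
          (terms k 0 n).card) s := by
  refine HasDerivAt.div_const ?_ _
  refine HasDerivAt.fun_sum fun t _ => ?_
  have := (((hasDerivAt_id s).mul_const (deviation k n t : ℂ)).cexp).const_mul
    ((deviation k n t : ℂ) ^ j)
  refine this.congr_deriv ?_
  simp only [id]
  ring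

theorem deviationMGF_eq_sum (k n : ℕ) : deviationMGF k n = fun s => (∑ t ∈ terms k 0 n,
    (deviation k n t : ℂ) ^ 0 * Complex.exp (s * deviation k n t)) / (terms k 0 n).card := by
  ext s
  simp only [deviationMGF, pow_zero, one_mul]

/-- Locally uniform convergence of holomorphic functions passes to derivatives; the first two
derivatives at `0` are the first two moments. -/
theorem tendsto_average_deviation {k : ℕ} (hk : 1 ≤ k) :
    Tendsto (fun n => (∑ t ∈ terms k 0 n, deviation k n t) / (terms k 0 n).card) atTop (𝓝 0) ∧
    Tendsto (fun n => (∑ t ∈ terms k 0 n, deviation k n t ^ 2) / (terms k 0 n).card) atTop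
      (𝓝 (leafRate k * (1 - leafRate k) / 4)) := by
  have h0 := tendstoLocallyUniformlyOn_deviationMGF hk
  have hd : ∀ n, deriv (deviationMGF k n) = fun s => (∑ t ∈ terms k 0 n,
      (deviation k n t : ℂ) ^ 1 * Complex.exp (s * deviation k n t)) / (terms k 0 n).card :=
    fun n => by
      ext s
      rw [deviationMGF_eq_sum, (hasDerivAt_sum_exp k n 0 s).deriv]
  have hdiff : ∀ n, Differentiable ℂ (deviationMGF k n) := fun n s => by
    rw [deviationMGF_eq_sum]
    exact (hasDerivAt_sum_exp k n 0 s).differentiableAt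
  have h1 := h0.deriv (.of_forall fun n => (hdiff n).differentiableOn) isOpen_univ
  have h2 := h1.deriv (.of_forall fun n => by
    rw [Function.comp_apply, hd]
    exact fun s _ => (hasDerivAt_sum_exp k n 1 s).differentiableAt.differentiableWithinAt) isOpen_univ
  set c : ℂ := leafRate k * (1 - leafRate k) / 8 with hc
  have d1 : deriv (fun s : ℂ => Complex.exp (c * s ^ 2)) =
      fun s => Complex.exp (c * s ^ 2) * (c * (2 * s)) := by
    ext s
    have := (((hasDerivAt_id s).pow 2).const_mul c).cexp.deriv
    simpa using this
  have d2 : deriv (deriv (fun s : ℂ => Complex.exp (c * s ^ 2))) 0 = c * 2 := by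
    rw [d1]
    have g1 := (((hasDerivAt_id (0 : ℂ)).pow 2).const_mul c).cexp
    have g2 := ((hasDerivAt_id (0 : ℂ)).const_mul 2).const_mul c
    have := (g1.mul g2).deriv
    simpa [Pi.mul_def] using this
  have t1 := (h1.tendsto_at (Set.mem_univ 0))
  have t2 := (h2.tendsto_at (Set.mem_univ 0))
  rw [d2] at t2
  rw [d1] at t1
  constructor
  · have := (Complex.continuous_re.tendsto _).comp t1
    simp only [mul_zero, Complex.zero_re] at this
    refine this.congr fun n => ?_
    simp only [Function.comp_apply, hd, zero_mul, Complex.exp_zero, pow_one, mul_one]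
    exact_mod_cast Complex.ofReal_re _
  · have := (Complex.continuous_re.tendsto _).comp t2
    have e : c * 2 = ((leafRate k * (1 - leafRate k) / 4 : ℝ) : ℂ) := by
      rw [hc]; push_cast; ring
    rw [e, Complex.ofReal_re] at this
    refine this.congr fun n => ?_
    simp only [Function.comp_apply, hd]
    rw [(hasDerivAt_sum_exp k n 1 0).deriv]
    simp only [zero_mul, Complex.exp_zero, mul_one]
    exact_mod_cast Complex.ofReal_re _

end MGF

/-! ### Mean, variance and the limit law of the random variable -/

section Law

open LambdaTerm (terms mem_terms uniformLaw numVars)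

theorem closedTerms_eq_coe_terms (k n : ℕ) :
    LambdaTerm.closedTerms k n = (terms k 0 n : Set LambdaTerm) := by
  ext t
  rw [Finset.mem_coe, mem_terms]
  rfl

theorem integral_uniformOn_finset {Ω E : Type*} [MeasurableSpace Ω] [MeasurableSingletonClass Ω]
    [NormedAddCommGroup E] [NormedSpace ℝ E] [CompleteSpace E] (s : Finset Ω) (f : Ω → E) :
    ∫ x, f x ∂(uniformOn (s : Set Ω)) = (s.card : ℝ)⁻¹ • ∑ x ∈ s, f x := by
  have hr : Measure.count.restrict (s : Set Ω) = ∑ x ∈ s, Measure.dirac x := by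
    ext t ht
    classical
    rw [Measure.restrict_apply ht, Measure.finsetSum_apply, Set.inter_comm]
    have : (s : Set Ω) ∩ t = ((s.filter (· ∈ t) : Finset Ω) : Set Ω) := by ext; simp
    rw [this, Measure.count_apply_finset, Finset.card_filter]
    simp [Set.indicator_apply, Measure.dirac_apply' _ ht]
  rw [uniformOn, ProbabilityTheory.cond, integral_smul_measure, Measure.count_apply_finset, hr,
    integral_finsetSum_measure fun x _ => integrable_dirac (by simp)]
  simp

theorem integral_uniformLaw {E : Type*} [NormedAddCommGroup E] [NormedSpace ℝ E] [CompleteSpace E]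
    (k n : ℕ) (f : LambdaTerm → E) :
    ∫ t, f t ∂(uniformLaw k n) = ((terms k 0 n).card : ℝ)⁻¹ • ∑ t ∈ terms k 0 n, f t := by
  rw [uniformLaw, closedTerms_eq_coe_terms, integral_uniformOn_finset]

theorem card_terms_ne_zero {k n : ℕ} (hk : 1 ≤ k) (hn : 2 ≤ n) :
    ((terms k 0 n).card : ℝ) ≠ 0 := by
  have h := LambdaTerm.nonempty_closedTerms hk hn
  rw [closedTerms_eq_coe_terms, Finset.coe_nonempty] at h
  exact_mod_cast h.card_pos.ne'

/-- The mean of `deviation k n`. -/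
noncomputable def deviationMean (k n : ℕ) : ℝ :=
  (∑ t ∈ terms k 0 n, deviation k n t) / (terms k 0 n).card

theorem X_eq {k n : ℕ} (hn : 0 < n) (t : LambdaTerm) :
    LambdaTerm.X t = leafRate k / 2 * n + √(n : ℝ) * deviation k n t := by
  have : √(n : ℝ) ≠ 0 := by positivity
  rw [deviation, LambdaTerm.X]
  field_simp
  ring

theorem integral_X {k n : ℕ} (hk : 1 ≤ k) (hn : 2 ≤ n) :
    ∫ t, LambdaTerm.X t ∂(uniformLaw k n) = leafRate k / 2 * n + √(n : ℝ) * deviationMean k n := by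
  have hc := card_terms_ne_zero hk hn
  rw [integral_uniformLaw, Finset.sum_congr rfl fun t _ => X_eq (k := k) (show 0 < n by omega) t,
    Finset.sum_add_distrib, Finset.sum_const, ← Finset.mul_sum, deviationMean, nsmul_eq_mul,
    smul_eq_mul]
  field_simp

theorem variance_X {k n : ℕ} (hk : 1 ≤ k) (hn : 2 ≤ n) :
    variance LambdaTerm.X (uniformLaw k n) =
      n * ((∑ t ∈ terms k 0 n, deviation k n t ^ 2) / (terms k 0 n).card -
        deviationMean k n ^ 2) := by
  have hc := card_terms_ne_zero hk hn
  have hm : Measurable LambdaTerm.X := fun _ _ => trivial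
  have hs : √(n : ℝ) ^ 2 = n := Real.sq_sqrt (Nat.cast_nonneg n)
  rw [variance_eq_integral hm.aemeasurable, integral_X hk hn, integral_uniformLaw]
  have h : ∀ t, (LambdaTerm.X t - (leafRate k / 2 * n + √(n : ℝ) * deviationMean k n)) ^ 2 =
      n * (deviation k n t ^ 2 - 2 * deviationMean k n * deviation k n t +
        deviationMean k n ^ 2) := fun t => by
    rw [X_eq (k := k) (show 0 < n by omega) t]
    linear_combination (deviation k n t - deviationMean k n) ^ 2 * hs
  have hd : ∑ t ∈ terms k 0 n, deviation k n t = deviationMean k n * (terms k 0 n).card := by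
    rw [deviationMean, div_mul_cancel₀ _ hc]
  rw [Finset.sum_congr rfl fun t _ => h t, ← Finset.mul_sum, Finset.sum_add_distrib,
    Finset.sum_sub_distrib, ← Finset.mul_sum, hd, Finset.sum_const, nsmul_eq_mul, smul_eq_mul]
  field_simp
  ring

theorem leafRate_mem {k : ℕ} (hk : 1 ≤ k) : 0 < leafRate k ∧ leafRate k < 1 := by
  have hs : 0 < √(k : ℝ) := Real.sqrt_pos.2 (by exact_mod_cast hk)
  have := one_add_two_sqrt_pos k
  refine ⟨by unfold leafRate; positivity, ?_⟩
  rw [leafRate, div_lt_one this]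
  linarith

theorem tendsto_integral_X_div {k : ℕ} (hk : 1 ≤ k) :
    Tendsto (fun n : ℕ => (∫ t, LambdaTerm.X t ∂(uniformLaw k n)) / n) atTop
      (𝓝 (leafRate k / 2)) := by
  have h1 : Tendsto (fun n : ℕ => leafRate k / 2 + deviationMean k n * (√(n : ℝ))⁻¹) atTop
      (𝓝 (leafRate k / 2 + 0 * 0)) :=
    ((tendsto_average_deviation hk).1.mul (tendsto_inv_atTop_zero.comp
      (Real.tendsto_sqrt_atTop.comp tendsto_natCast_atTop_atTop))).const_add _
  rw [mul_zero, add_zero] at h1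
  refine h1.congr' ?_
  filter_upwards [eventually_ge_atTop 2] with n hn
  have hn' : (0 : ℝ) < n := by positivity
  have hs : √(n : ℝ) ^ 2 = n := Real.sq_sqrt hn'.le
  have hs' : √(n : ℝ) ≠ 0 := by positivity
  rw [integral_X hk hn, eq_div_iff hn'.ne']
  nth_rewrite 3 [← hs]
  field_simp
  rw [hs]
  ring

theorem tendsto_variance_X_div {k : ℕ} (hk : 1 ≤ k) :
    Tendsto (fun n : ℕ => variance LambdaTerm.X (uniformLaw k n) / n) atTop
      (𝓝 (leafRate k * (1 - leafRate k) / 4)) := by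
  obtain ⟨h1, h2⟩ := tendsto_average_deviation hk
  have h3 := h2.sub (h1.pow 2)
  rw [zero_pow two_ne_zero, sub_zero] at h3
  refine h3.congr' ?_
  filter_upwards [eventually_ge_atTop 2] with n hn
  have hn' : (n : ℝ) ≠ 0 := by positivity
  rw [variance_X hk hn, mul_div_cancel_left₀ _ hn']
  rfl

theorem isEquivalent_of_tendsto_div {f : ℕ → ℝ} {c : ℝ} (hc : c ≠ 0)
    (h : Tendsto (fun n => f n / n) atTop (𝓝 c)) : f ~[atTop] fun n => c * n := by
  refine isEquivalent_of_tendsto_one ?_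
  have := h.div_const c
  rw [div_self hc] at this
  refine this.congr fun n => ?_
  rw [Pi.div_apply, div_div, mul_comm c]

/-- The standardized number of variables. -/
noncomputable def standardizedX (k n : ℕ) (t : LambdaTerm) : ℝ :=
  (LambdaTerm.X t - ∫ s, LambdaTerm.X s ∂(uniformLaw k n)) /
    √(variance LambdaTerm.X (uniformLaw k n))

theorem measurable_standardizedX (k n : ℕ) : Measurable (standardizedX k n) := fun _ _ => trivial

/-- The standardized variable is the deviation minus its mean, divided by `d n`. So its
characteristic function is `deviationMGF` at the moving point `iθ / d n`, times a phase tending to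
`1` because the mean tends to `0`. -/
theorem tendsto_charFun_standardizedX {k : ℕ} (hk : 1 ≤ k) (θ : ℝ) :
    Tendsto (fun n => charFun ((uniformLaw k n).map (standardizedX k n)) θ) atTop
      (𝓝 (charFun (gaussianReal 0 1) θ)) := by
  obtain ⟨hr0, hr1⟩ := leafRate_mem hk
  set σ : ℝ := √(leafRate k * (1 - leafRate k) / 4) with hσ
  have hσ2 : σ ^ 2 = leafRate k * (1 - leafRate k) / 4 :=
    Real.sq_sqrt (by have := mul_pos hr0 (sub_pos.2 hr1); positivity)
  have hσ0 : σ ≠ 0 := by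
    have := mul_pos hr0 (sub_pos.2 hr1)
    positivity
  set d : ℕ → ℝ := fun n => √(variance LambdaTerm.X (uniformLaw k n) / n) with hd
  have hdt : Tendsto d atTop (𝓝 σ) := (tendsto_variance_X_div hk).sqrt
  have hs : Tendsto (fun n => ((θ / d n : ℝ) : ℂ) * Complex.I) atTop
      (𝓝 (((θ / σ : ℝ) : ℂ) * Complex.I)) :=
    ((Complex.continuous_ofReal.tendsto _).comp (tendsto_const_nhds.div hdt hσ0)).mul_const _
  have h1 := tendsto_deviationMGF hk tendsto_id hs
  have h2 : Tendsto (fun n => Complex.exp (-((deviationMean k n : ℝ) : ℂ) *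
      (((θ / d n : ℝ) : ℂ) * Complex.I))) atTop
      (𝓝 (Complex.exp (-((0 : ℝ) : ℂ) * (((θ / σ : ℝ) : ℂ) * Complex.I)))) :=
    ((((Complex.continuous_ofReal.tendsto _).comp
      (tendsto_average_deviation hk).1).neg).mul hs).cexp
  have h3 := h1.mul h2
  have e : Complex.exp (leafRate k * (1 - leafRate k) / 8 * (((θ / σ : ℝ) : ℂ) * Complex.I) ^ 2) *
      Complex.exp (-((0 : ℝ) : ℂ) * (((θ / σ : ℝ) : ℂ) * Complex.I)) =
      charFun (gaussianReal 0 1) θ := by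
    rw [charFun_gaussianReal, ← Complex.exp_add]
    congr 1
    have h4 : ((leafRate k : ℂ) * (1 - leafRate k) / 4) = (σ : ℂ) ^ 2 := by
      exact_mod_cast hσ2.symm
    have h5 : (σ : ℂ) ≠ 0 := by exact_mod_cast hσ0
    rw [show (leafRate k : ℂ) * (1 - leafRate k) / 8 = (σ : ℂ) ^ 2 / 2 by rw [← h4]; ring,
      mul_pow, Complex.I_sq]
    push_cast
    field_simp
    simp
    ring
  rw [e] at h3
  refine h3.congr' ?_
  filter_upwards [eventually_ge_atTop 2] with n hn
  have hn' : (0 : ℝ) < n := by positivity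
  have hsn : √(n : ℝ) ≠ 0 := by positivity
  have hZ : ∀ t, standardizedX k n t = (deviation k n t - deviationMean k n) / d n := fun t => by
    have hdn : √(variance LambdaTerm.X (uniformLaw k n)) = √(n : ℝ) * d n := by
      rw [hd, ← Real.sqrt_mul hn'.le, mul_div_cancel₀ _ hn'.ne']
    rw [standardizedX, hdn, integral_X hk hn, X_eq (k := k) (show 0 < n by omega) t,
      add_sub_add_left_eq_sub, ← mul_sub, mul_div_mul_left _ _ hsn]
  rw [charFun_apply_real, integral_map (measurable_standardizedX k n).aemeasurable
    (by fun_prop), integral_uniformLaw, id, deviationMGF, Complex.real_smul]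
  rw [div_mul_eq_mul_div, Finset.sum_mul, div_eq_inv_mul]
  push_cast
  congr 1
  refine Finset.sum_congr rfl fun t _ => ?_
  rw [← Complex.exp_add, hZ]
  congr 1
  push_cast
  ring

theorem tendsto_cdf_standardizedX {k : ℕ} (hk : 1 ≤ k) (x : ℝ) :
    Tendsto (fun n => (uniformLaw k n).real {t | standardizedX k n t ≤ x}) atTop
      (𝓝 ((gaussianReal 0 1).real (Set.Iic x))) := by
  -- For `n ≥ 2` the laws are probability measures, as Lévy's theorem requires.
  rw [← tendsto_add_atTop_iff_nat 2]
  have hp : ∀ n, IsProbabilityMeasure ((uniformLaw k (n + 2)).map (standardizedX k (n + 2))) :=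
    fun n => by
      have := LambdaTerm.isProbabilityMeasure_uniformLaw hk (show 2 ≤ n + 2 by omega)
      exact Measure.isProbabilityMeasure_map (measurable_standardizedX _ _).aemeasurable
  let ν : ProbabilityMeasure ℝ := ⟨gaussianReal 0 1, inferInstance⟩
  let μ : ℕ → ProbabilityMeasure ℝ := fun n => ⟨_, hp n⟩
  have h1 : Tendsto μ atTop (𝓝 ν) :=
    ProbabilityMeasure.tendsto_iff_tendsto_charFun.2 fun θ =>
      (tendsto_charFun_standardizedX hk θ).comp (tendsto_add_atTop_nat 2)
  have h2 := ProbabilityMeasure.tendsto_measure_of_null_frontier_of_tendsto' h1 (E := Set.Iic x)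
    (by
      have := nullSingletonClass_gaussianReal (μ := 0) (v := 1) one_ne_zero
      rw [frontier_Iic]
      exact measure_singleton (μ := gaussianReal 0 1) x)
  have h3 := (ENNReal.tendsto_toReal (measure_ne_top (gaussianReal 0 1) (Set.Iic x))).comp h2
  refine h3.congr fun n => ?_
  simp only [Function.comp_apply, μ, ProbabilityMeasure.coe_mk]
  rw [Measure.map_apply (measurable_standardizedX _ _) measurableSet_Iic]
  rfl

end Law

theorem mainTheorem1 (k : ℕ) (hk : 1 ≤ k) :
    (∀ x : ℝ, Tendsto
      (fun n : ℕ => (LambdaTerm.uniformLaw k n).real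
        {t | (LambdaTerm.X t - ∫ s, LambdaTerm.X s ∂(LambdaTerm.uniformLaw k n)) /
          √(variance LambdaTerm.X (LambdaTerm.uniformLaw k n)) ≤ x})
      atTop (𝓝 ((gaussianReal 0 1).real (Set.Iic x)))) ∧
    (fun n : ℕ => ∫ t, LambdaTerm.X t ∂(LambdaTerm.uniformLaw k n)) ~[atTop]
      (fun n : ℕ => (k : ℝ) / (√(k : ℝ) + 2 * k) * n) ∧
    (fun n : ℕ => variance LambdaTerm.X (LambdaTerm.uniformLaw k n)) ~[atTop]
      (fun n : ℕ => (k : ℝ) ^ 2 / (2 * √(k : ℝ) * (√(k : ℝ) + 2 * k) ^ 2) * n) := by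
  obtain ⟨hr0, hr1⟩ := leafRate_mem hk
  have hs : 0 < √(k : ℝ) := Real.sqrt_pos.2 (by exact_mod_cast hk)
  have hk2 : (k : ℝ) = √(k : ℝ) ^ 2 := (Real.sq_sqrt (Nat.cast_nonneg k)).symm
  -- Both sides equal `√k / (1 + 2√k)`; the two sides of `hvar` equal `√k / (2 (1 + 2√k)²)`.
  have hmean : leafRate k / 2 = (k : ℝ) / (√(k : ℝ) + 2 * k) := by
    rw [leafRate]
    generalize √(k : ℝ) = q at *
    rw [hk2]
    field_simp
  have hvar : leafRate k * (1 - leafRate k) / 4 =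
      (k : ℝ) ^ 2 / (2 * √(k : ℝ) * (√(k : ℝ) + 2 * k) ^ 2) := by
    rw [leafRate]
    generalize √(k : ℝ) = q at *
    rw [hk2]
    field_simp
    ring
  refine ⟨fun x => tendsto_cdf_standardizedX hk x, ?_, ?_⟩
  · rw [← hmean]
    exact isEquivalent_of_tendsto_div (by positivity) (tendsto_integral_X_div hk)
  · rw [← hvar]
    have := mul_pos hr0 (sub_pos.2 hr1)
    exact isEquivalent_of_tendsto_div (by positivity) (tendsto_variance_X_div hk)
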